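/- A max-min LP has finite sets $V$ (agents), $I$ (constraints), $K$ (objectives) and nonnegative real coefficients $a_{iv}$, $c_{kv}$. The task is to maximise $\omega(x)=\min_{k\in K}\sum_{v\in V} c_{kv}x_v$ subject to $\sum_{v\in V} a_{iv}x_v\le 1$ for all $i\in I$ and $x_v\ge 0$ for all $v\in V$. Its communication graph has node set $V\cup I\cup K$; an agent $v$ is adjacent to the constraints $i$ with $a_{iv}>0$ and to the objectives $k$ with $c_{kv}>0$. We consider instances in which every agent is adjacent to at least one constraint, every constraint is adjacent to at most $\Delta_I$ agents, and every objective is adjacent to at most $\Delta_K$ agents. In the port-numbering model each node $s$ numbers its incident edges $1,\dots,\deg s$. An agent initially knows, for every port, whether it leads to a constraint or to an objective and the coefficient of that edge; a constraint or objective knows its number of ports. The local view of radius $D$ of a node is the depth-$D$ tree of all the local inputs and port numbers reachable along walks of length at most $D$ from it. A local algorithm with local horizon $D$ is a function that maps the radius-$D$ view of each agent $v$ to its output $x_v$. It has approximation ratio $\alpha$ (for $\Delta_I,\Delta_K$) if on every such instance, with every port numbering, its output $x$ is feasible and $\omega(y)\le\alpha\,\omega(x)$ for every feasible $y$. **Theorem.**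 1. For all integers $\Delta_I\ge 2$, $\Delta_K\ge 2$ and every $\epsilon>0$ there is a local algorithm in the port-numbering model, without node identifiers and with constant local horizon, that has approximation ratio $\Delta_I(1-1/\Delta_K)+\epsilon$. 2. More precisely, there is a function $D(R)=\Theta(R)$ such that for every integer $R\ge 2$ there is a local algorithm in the port-numbering model, without node identifiers and with local horizon $D(R)$, that has, for all $\Delta_I\ge2$ and $\Delta_K\ge2$ simultaneously, approximation ratio $\Delta_I(1-1/\Delta_K)\bigl(1+\tfrac1{R-1}\bigr)$. 3. This is optimal: for all $\Delta_I\ge 2$ and $\Delta_K\ge 2$, every approximation ratio $\alpha$ of a local algorithm satisfies $\alpha>\Delta_I(1-1/\Delta_K)$, even if the nodes additionally have unique natural-number identifiers, which are then part of the local inputs, and the algorithm only has to succeed when the identifiers are distinct. -/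

import Mathlib

open Asymptotics Filter

/-- A max-min linear program with agents `V`, constraints `I` and objectives `K`, given by the
nonnegative matrices `a` and `c`: maximise `min_k ∑ v, c k v * x v` subject to
`∑ v, a i v * x v ≤ 1` for all `i` and `x ≥ 0`. -/
structure MaxMinLP (V I K : Type) where
  /-- the constraint coefficients -/
  a : I → V → ℝ
  /-- the objective coefficients -/
  c : K → V → ℝ
  a_nonneg : ∀ i v, 0 ≤ a i v
  c_nonneg : ∀ k v, 0 ≤ c k v

/-- The nodes of the communication graph: agents, constraints and objectives. -/
inductive Node (V I K : Type) : Type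
  | agent (v : V) : Node V I K
  | constraint (i : I) : Node V I K
  | objective (k : K) : Node V I K

/-- The three types of nodes. -/
inductive NodeKind : Type
  | agent : NodeKind
  | constraint : NodeKind
  | objective : NodeKind

/-- The type of a node. -/
def Node.kind {V I K : Type} : Node V I K → NodeKind
  | .agent _ => .agent
  | .constraint _ => .constraint
  | .objective _ => .objective

namespace MaxMinLP

variable {V I K : Type}

/-- The coefficient associated with a pair of nodes: `a i v` for an agent and a constraint,
`c k v` for an agent and an objective, and `0` for all other pairs. -/
def coeff (P : MaxMinLP V I K) : Node V I K → Node V I K → ℝ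
  | .agent v, .constraint i => P.a i v
  | .constraint i, .agent v => P.a i v
  | .agent v, .objective k => P.c k v
  | .objective k, .agent v => P.c k v
  | _, _ => 0

theorem coeff_comm (P : MaxMinLP V I K) (s t : Node V I K) : P.coeff s t = P.coeff t s := by
  cases s <;> cases t <;> rfl

/-- The communication graph: an agent is adjacent to exactly those constraints and objectives
in which it has a positive coefficient. -/
def graph (P : MaxMinLP V I K) : SimpleGraph (Node V I K) where
  Adj s t := 0 < P.coeff s t
  symm := ⟨fun s t h => by rw [P.coeff_comm t s]; exact h⟩
  loopless := ⟨fun s h => by cases s <;> exact lt_irrefl _ h⟩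

/-- The feasible solutions. -/
def Feasible [Fintype V] (P : MaxMinLP V I K) (x : V → ℝ) : Prop :=
  (∀ i, ∑ v, P.a i v * x v ≤ 1) ∧ ∀ v, 0 ≤ x v

/-- The utility `min_k ∑ v, c k v * x v` of a solution `x`. -/
noncomputable def utility [Fintype V] (P : MaxMinLP V I K) (x : V → ℝ) : ℝ :=
  ⨅ k, ∑ v, P.c k v * x v

/-- Every agent is adjacent to some constraint (otherwise the optimum may be infinite), every
constraint to at most `ΔI` agents, and every objective to at most `ΔK` agents. -/
def Admissible (P : MaxMinLP V I K) (ΔI ΔK : ℕ) : Prop :=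
  (∀ v, ∃ i, 0 < P.a i v) ∧
  (∀ i, {v | 0 < P.a i v}.ncard ≤ ΔI) ∧
  (∀ k, {v | 0 < P.c k v}.ncard ≤ ΔK)

end MaxMinLP

/-- A max-min LP together with a port numbering of its communication graph (the ports of a node
`s` are numbered by `Fin (deg s)`, and `nbr s p` is the neighbour behind port `p`) and a label in
`L` for every node. Taking `L = Unit` means that the nodes are anonymous. -/
structure Network (L V I K : Type) extends MaxMinLP V I K where
  /-- the number of ports of a node -/
  deg : Node V I K → ℕ
  /-- the neighbours of a node, numbered by its ports -/
  nbr : (s : Node V I K) → Fin (deg s) ≃ toMaxMinLP.graph.neighborSet s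
  /-- the label of a node -/
  label : Node V I K → L

/-- The local input of a node. An agent knows, for each of its ports in order, whether it leads to
a constraint or to an objective, and the coefficient of the edge. A constraint or an objective
knows only its number of ports. Every node knows its type and its label. -/
inductive LocalInput (L : Type) : Type
  | agent (label : L) (edges : List (NodeKind × ℝ)) : LocalInput L
  | constraint (label : L) (deg : ℕ) : LocalInput L
  | objective (label : L) (deg : ℕ) : LocalInput L

/-- The possible local views of radius `D`: the local input of the node and, for `D > 0` and for
each port of the node in order, the port number at the other end of the edge together with the
view of radius `D - 1` of the neighbour. -/
def View (L : Type) : ℕ → Type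
  | 0 => LocalInput L
  | D + 1 => LocalInput L × List (ℕ × View L D)

namespace Network

variable {L V I K : Type}

/-- The local input of a node of a network. -/
def localInput (N : Network L V I K) (s : Node V I K) : LocalInput L :=
  match s with
  | .agent v => .agent (N.label (.agent v)) (List.ofFn fun p : Fin (N.deg (.agent v)) =>
      ((N.nbr (.agent v) p).1.kind, N.coeff (.agent v) (N.nbr (.agent v) p).1))
  | .constraint i => .constraint (N.label (.constraint i)) (N.deg (.constraint i))
  | .objective k => .objective (N.label (.objective k)) (N.deg (.objective k))

/-- The port number, in the neighbour behind port `p` of `s`, of the edge that leads back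
to `s`. -/
def backPort (N : Network L V I K) (s : Node V I K) (p : Fin (N.deg s)) :
    Fin (N.deg (N.nbr s p).1) :=
  (N.nbr (N.nbr s p).1).symm ⟨s, N.graph.adj_symm (N.nbr s p).2⟩

/-- The local view of radius `D` of a node: all the information that it can gather, in the
port-numbering model, from the nodes within distance `D`. -/
def view (N : Network L V I K) : (D : ℕ) → Node V I K → View L D
  | 0, s => N.localInput s
  | D + 1, s => (N.localInput s, List.ofFn fun p : Fin (N.deg s) =>
      ((N.backPort s p : ℕ), N.view D (N.nbr s p).1))

end Network

/-- A (deterministic) local algorithm with local horizon `D`: the output of an agent is a function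
of its local view of radius `D`. -/
def LocalAlgorithm (L : Type) (D : ℕ) : Type := View L D → ℝ

namespace LocalAlgorithm

/-- The solution that a local algorithm computes on a network. -/
def output {L V I K : Type} {D : ℕ} (𝒜 : LocalAlgorithm L D) (N : Network L V I K) : V → ℝ :=
  fun v => 𝒜 (N.view D (.agent v))

/-- On the network `N`, the algorithm outputs an `α`-approximate solution: it is feasible, and no
feasible solution has a utility larger than `α` times its utility. -/
def ApproximatesOn {L V I K : Type} [Fintype V] {D : ℕ} (𝒜 : LocalAlgorithm L D)
    (N : Network L V I K) (α : ℝ) : Prop :=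
  N.Feasible (𝒜.output N) ∧ ∀ y, N.Feasible y → N.utility y ≤ α * N.utility (𝒜.output N)

/-- Approximation ratio `α` in the port-numbering model, without node identifiers. -/
def HasRatio {D : ℕ} (𝒜 : LocalAlgorithm Unit D) (ΔI ΔK : ℕ) (α : ℝ) : Prop :=
  ∀ (V I K : Type) [Fintype V] [Finite I] [Finite K] (N : Network Unit V I K),
    N.Admissible ΔI ΔK → 𝒜.ApproximatesOn N α

/-- Approximation ratio `α` in the port-numbering model with unique node identifiers. -/
def HasRatioWithIdentifiers {D : ℕ} (𝒜 : LocalAlgorithm ℕ D) (ΔI ΔK : ℕ) (α : ℝ) : Prop :=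
  ∀ (V I K : Type) [Fintype V] [Finite I] [Finite K] (N : Network ℕ V I K),
    Function.Injective N.label → N.Admissible ΔI ΔK → 𝒜.ApproximatesOn N α

end LocalAlgorithm

/-! Approximation. Fix a target for each objective and propagate bounds: from the lower bounds 0,
the constraints give each agent an upper bound, the objectives then force new lower bounds, and so
on. Every feasible solution that meets the targets stays between these bounds (`Feasible.bounds`),
so targets not above the optimum are never refuted by a lower bound exceeding an upper bound.
`localTarget` is the largest common target that is not refuted nearby in `n` rounds. It is at least
the optimum, and the resulting non-uniform targets are still consistent everywhere
(`consistent_localTarget`).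

Let `X d` and `Z d` be the sums of upper and lower bounds in round `d`, weighted by the coefficients
of one constraint or objective with `m` agents. Adding the defining inequalities over its agents
gives `X d + Z d ≤ max 2 m` for a constraint, and `X d + Z (d + 1) ≥ s m / (m - 1)` for an objective
with target `s` and `m ≥ 2`. The solution sums the second pairing over `n` rounds. Since `Z 0 = 0`,
shifting the index costs a constraint only one extra `Z n`, which is at most `m`; hence the factor
`(n + 1) / n`. Dividing by the largest local `max 2 m`, instead of the unknown `ΔI`, makes the
solution feasible. It is local because equal views yield equal values
(`localSolution_eq_of_view_eq`).

Optimality. Write `p`, `q` for the two degree bounds. In an infinite network over the free group on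
`Fin p × Fin q`, right multiplications preserve all ports. Its finite truncation has a feasible
solution of utility above `q - 1` (`lt_utility_treeSolution`). Averaged over all assignments of
identifiers, the outputs at two agents of the same type close to the identity agree
(`sum_output_shift`). The `q` constraints at the identity bound the sum of the `p q` averages by
`q`, while the `p` objectives at the identity force it above `p (q - 1) / α`. Hence `α > p (1 - 1 /
q)`. -/

namespace MaxMinLP

variable {V I K : Type}

/-! ### Walks, iterated bounds and the averaged solution -/

/-- There is a walk of length at most `n` from `s` to `t`. -/
def Near (P : MaxMinLP V I K) (n : ℕ) (s t : Node V I K) : Prop :=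
  ∃ p : P.graph.Walk s t, p.length ≤ n

theorem Near.mono {P : MaxMinLP V I K} {m n : ℕ} {s t : Node V I K} (h : P.Near m s t)
    (hmn : m ≤ n) : P.Near n s t :=
  ⟨h.choose, h.choose_spec.trans hmn⟩

theorem Near.symm {P : MaxMinLP V I K} {n : ℕ} {s t : Node V I K} (h : P.Near n s t) :
    P.Near n t s :=
  ⟨h.choose.reverse, by simpa using h.choose_spec⟩

theorem Near.cons {P : MaxMinLP V I K} {n : ℕ} {s t u : Node V I K} (hs : 0 < P.coeff s u)
    (h : P.Near n u t) : P.Near (n + 1) s t :=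
  ⟨.cons (show P.graph.Adj s u from hs) h.choose, by simpa using h.choose_spec⟩

theorem near_succ_iff {P : MaxMinLP V I K} {n : ℕ} {s t : Node V I K} :
    P.Near (n + 1) s t ↔ P.Near n s t ∨ ∃ u : P.graph.neighborSet s, P.Near n u.1 t := by
  constructor
  · rintro ⟨p, hp⟩
    cases p with
    | nil => exact .inl ⟨.nil, by simp⟩
    | cons h p => exact .inr ⟨⟨_, h⟩, p, by simpa using hp⟩
  · rintro (h | ⟨⟨u, hu⟩, h⟩)
    · exact h.mono n.le_succ
    · exact Near.cons hu h

theorem near_zero_iff {P : MaxMinLP V I K} {s t : Node V I K} : P.Near 0 s t ↔ s = t := by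
  constructor
  · rintro ⟨p, hp⟩
    exact SimpleGraph.Walk.eq_of_length_eq_zero (p := p) (by omega)
  · rintro rfl
    exact ⟨.nil, by simp⟩

/-- The weight of an agent in the local solution. -/
noncomputable def weight (P : MaxMinLP V I K) (v : V) : ℝ :=
  ⨅ i : {i // 0 < P.a i v}, (max 2 ({u | 0 < P.a i u}.ncard : ℝ))⁻¹

variable [Fintype V]

/-- The largest value that the constraints of the agent `v` allow it when the other agents
take the values `z`. -/
noncomputable def upperBound (P : MaxMinLP V I K) (z : V → ℝ) (v : V) : ℝ :=
  ⨅ i : {i // 0 < P.a i v}, ((1 - ∑ u, P.a i u * z u) / P.a i v + z v)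

/-- The smallest nonnegative value of the agent `v` with which all its objectives `k` reach the
target `s k` when the other agents take the values `x`. -/
noncomputable def lowerBound (P : MaxMinLP V I K) (s : K → ℝ) (x : V → ℝ) (v : V) : ℝ :=
  max 0 (⨆ k : {k // 0 < P.c k v}, ((s k - ∑ w, P.c k w * x w) / P.c k v + x v))

/-- The iterated lower bounds on the values of the agents for the targets `s`. -/
noncomputable def lowerIter (P : MaxMinLP V I K) (s : K → ℝ) : ℕ → V → ℝ
  | 0 => 0
  | d + 1 => P.lowerBound s (P.upperBound (lowerIter P s d))

/-- The iterated upper bounds on the values of the agents for the targets `s`. -/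
noncomputable def upperIter (P : MaxMinLP V I K) (s : K → ℝ) (d : ℕ) : V → ℝ :=
  P.upperBound (P.lowerIter s d)

/-- In the first `n` rounds the lower bounds of `v` do not exceed the upper bounds. -/
def Consistent (P : MaxMinLP V I K) (n : ℕ) (s : K → ℝ) (v : V) : Prop :=
  ∀ d < n, P.lowerIter s (d + 1) v ≤ P.upperIter s d v

/-- The largest common target that is consistent for all agents in a neighbourhood of `k`. -/
noncomputable def localTarget (P : MaxMinLP V I K) (n : ℕ) (k : K) : ℝ :=
  sSup {ω | ∀ v, P.Near (4 * n) (.objective k) (.agent v) → P.Consistent n (fun _ => ω) v}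

/-- The averaged solution over `n` rounds. -/
noncomputable def localSolution (P : MaxMinLP V I K) (n : ℕ) (v : V) : ℝ :=
  P.weight v / (n + 1) * ∑ d ∈ Finset.range n,
    (P.upperIter (P.localTarget n) d v + P.lowerIter (P.localTarget n) (d + 1) v)

/-! ### Elementary properties of the bounds -/

section Bounds

variable {P : MaxMinLP V I K}

theorem upperBound_le [Finite I] {z : V → ℝ} {v : V} {i : I} (hi : 0 < P.a i v) :
    P.upperBound z v ≤ (1 - ∑ u, P.a i u * z u) / P.a i v + z v :=
  ciInf_le (Set.finite_range _).bddBelow (⟨i, hi⟩ : {i // 0 < P.a i v})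

theorem mul_upperBound_le [Finite I] {z : V → ℝ} {v : V} {i : I} (hi : 0 < P.a i v) :
    P.a i v * P.upperBound z v ≤ 1 - ∑ u, P.a i u * z u + P.a i v * z v := by
  have h := mul_le_mul_of_nonneg_left (upperBound_le (z := z) hi) hi.le
  rwa [mul_add, mul_div_cancel₀ _ hi.ne'] at h

theorem le_lowerBound [Finite K] {s : K → ℝ} {x : V → ℝ} {v : V} {k : K} (hk : 0 < P.c k v) :
    (s k - ∑ w, P.c k w * x w) / P.c k v + x v ≤ P.lowerBound s x v :=
  le_max_of_le_right
    (le_ciSup (f := fun k : {k // 0 < P.c k v} => (s k - ∑ w, P.c k w * x w) / P.c k v + x v)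
      (Set.finite_range _).bddAbove ⟨k, hk⟩)

theorem le_mul_lowerBound [Finite K] {s : K → ℝ} {x : V → ℝ} {v : V} {k : K}
    (hk : 0 < P.c k v) :
    s k - ∑ w, P.c k w * x w + P.c k v * x v ≤ P.c k v * P.lowerBound s x v := by
  have h := mul_le_mul_of_nonneg_left (le_lowerBound (s := s) (x := x) hk) hk.le
  rwa [mul_add, mul_div_cancel₀ _ hk.ne'] at h

theorem le_upperBound {z : V → ℝ} {v : V} {y : ℝ} (hv : ∃ i, 0 < P.a i v)
    (h : ∀ i, 0 < P.a i v → y ≤ (1 - ∑ u, P.a i u * z u) / P.a i v + z v) :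
    y ≤ P.upperBound z v :=
  have : Nonempty {i // 0 < P.a i v} := hv.elim fun i hi => ⟨⟨i, hi⟩⟩
  le_ciInf fun i => h i.1 i.2

theorem lowerBound_le {s : K → ℝ} {x : V → ℝ} {v : V} {y : ℝ} (hy : 0 ≤ y)
    (h : ∀ k, 0 < P.c k v → (s k - ∑ w, P.c k w * x w) / P.c k v + x v ≤ y) :
    P.lowerBound s x v ≤ y :=
  max_le hy (Real.iSup_le (fun k => h k.1 k.2) hy)

theorem lowerBound_nonneg {s : K → ℝ} {x : V → ℝ} {v : V} : 0 ≤ P.lowerBound s x v :=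
  le_max_left _ _

theorem lowerIter_nonneg {s : K → ℝ} : ∀ {d : ℕ} {v : V}, 0 ≤ P.lowerIter s d v
  | 0, _ => le_rfl
  | _ + 1, _ => lowerBound_nonneg

/-- A weighted sum minus one of its terms is monotone in the other variables. -/
theorem sum_sub_le_sum_sub {w : V → ℝ} (hw : ∀ u, 0 ≤ w u) {x y : V → ℝ}
    (h : ∀ u, 0 < w u → x u ≤ y u) (v : V) :
    ∑ u, w u * x u - w v * x v ≤ ∑ u, w u * y u - w v * y v := by
  classical
  rw [← Finset.add_sum_erase _ _ (Finset.mem_univ v),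
    ← Finset.add_sum_erase _ (fun u => w u * y u) (Finset.mem_univ v), add_sub_cancel_left,
    add_sub_cancel_left]
  refine Finset.sum_le_sum fun u _ => ?_
  rcases (hw u).eq_or_lt with h0 | h0
  · simp [← h0]
  · exact mul_le_mul_of_nonneg_left (h u h0) h0.le

theorem div_add_eq {c t x : ℝ} (hc : 0 < c) : t / c + x = (t + c * x) / c := by
  field_simp

/-- The term of `v` itself cancels in the bound, so only the other agents of its constraints count.
Restricting the comparison to agents that share a constraint with `v` is what later yields locality.
-/
theorem upperBound_anti [Finite I] {z z' : V → ℝ} {v : V} (hv : ∃ i, 0 < P.a i v)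
    (h : ∀ i u, 0 < P.a i v → 0 < P.a i u → z u ≤ z' u) :
    P.upperBound z' v ≤ P.upperBound z v := by
  refine le_upperBound hv fun i hi => (upperBound_le hi).trans ?_
  rw [div_add_eq hi, div_add_eq hi]
  have := sum_sub_le_sum_sub (P.a_nonneg i) (fun u hu => h i u hi hu) v
  gcongr ?_ / _
  linarith

theorem lowerBound_mono [Finite K] {s s' : K → ℝ} {x x' : V → ℝ} {v : V}
    (hs : ∀ k, 0 < P.c k v → s k ≤ s' k)
    (h : ∀ k w, 0 < P.c k v → 0 < P.c k w → x' w ≤ x w) :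
    P.lowerBound s x v ≤ P.lowerBound s' x' v := by
  refine lowerBound_le lowerBound_nonneg fun k hk => le_trans ?_ (le_lowerBound hk)
  rw [div_add_eq hk, div_add_eq hk]
  have := sum_sub_le_sum_sub (P.c_nonneg k) (fun u hu => h k u hk hu) v
  have := hs k hk
  gcongr ?_ / _
  linarith

/-- The iterated bounds enclose every feasible solution that reaches the targets. -/
theorem Feasible.bounds {y : V → ℝ} (hy : P.Feasible y) (hP : ∀ v, ∃ i, 0 < P.a i v)
    {s : K → ℝ} (hs : ∀ k, s k ≤ ∑ v, P.c k v * y v) (d : ℕ) :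
    (∀ v, P.lowerIter s d v ≤ y v) ∧ ∀ v, y v ≤ P.upperIter s d v := by
  -- Valid lower bounds make the upper bounds of the same round valid, whatever the round.
  have key : ∀ d, (∀ v, P.lowerIter s d v ≤ y v) → ∀ v, y v ≤ P.upperIter s d v := by
    intro d h v
    refine le_upperBound (hP v) fun i hi => ?_
    rw [div_add_eq hi, le_div_iff₀ hi]
    have := sum_sub_le_sum_sub (P.a_nonneg i) (fun u _ => h u) v
    have := hy.1 i
    linarith
  induction d with
  | zero => exact ⟨hy.2, key 0 hy.2⟩
  | succ d ih =>
    have hl : ∀ v, P.lowerIter s (d + 1) v ≤ y v := by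
      intro v
      refine lowerBound_le (hy.2 v) fun k hk => ?_
      rw [div_add_eq hk, div_le_iff₀ hk]
      have : ∑ u, P.c k u * y u - P.c k v * y v ≤ _ :=
        sum_sub_le_sum_sub (P.c_nonneg k) (fun u _ => ih.2 u) v
      have := hs k
      simp only [upperIter] at *
      linarith
    exact ⟨hl, key _ hl⟩

end Bounds

end MaxMinLP

/-! ### Monotonicity in the targets, continuity, and consistency of the local targets -/

namespace MaxMinLP

variable {V I K : Type} {P : MaxMinLP V I K}

theorem weight_le [Finite I] {i : I} {v : V} (hi : 0 < P.a i v) :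
    P.weight v ≤ (max 2 ({u | 0 < P.a i u}.ncard : ℝ))⁻¹ :=
  ciInf_le (f := fun i : {i // 0 < P.a i v} => (max 2 ({u | 0 < P.a i.1 u}.ncard : ℝ))⁻¹)
    (Set.finite_range _).bddBelow ⟨i, hi⟩

theorem inv_le_weight {ΔI ΔK : ℕ} (hP : P.Admissible ΔI ΔK) (hΔI : 2 ≤ ΔI) (v : V) :
    (ΔI : ℝ)⁻¹ ≤ P.weight v := by
  have : Nonempty {i // 0 < P.a i v} := (hP.1 v).elim fun i hi => ⟨⟨i, hi⟩⟩
  refine le_ciInf fun i => inv_anti₀ (by positivity) (max_le (by exact_mod_cast hΔI) ?_)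
  exact_mod_cast hP.2.1 i

variable [Fintype V]

/-- The iterated lower bounds are monotone in the targets, and they depend only on the targets in
a neighbourhood. -/
theorem lowerIter_le_of_near [Finite I] [Finite K] (hP : ∀ v, ∃ i, 0 < P.a i v) {s s' : K → ℝ} :
    ∀ (d : ℕ) (v : V), (∀ k, P.Near (4 * d) (.agent v) (.objective k) → s k ≤ s' k) →
      P.lowerIter s d v ≤ P.lowerIter s' d v := by
  intro d
  induction d with
  | zero => exact fun v _ => le_rfl
  | succ d ih =>
    intro v h
    refine lowerBound_mono (fun k hk => h k ?_) fun k w hv hw => ?_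
    · exact (Near.cons (n := 0) (s := .agent v) (u := .objective k) hk (near_zero_iff.2 rfl)).mono (by omega)
    · refine upperBound_anti (hP w) fun i u hw' hu => ih u fun l hl => h l ?_
      exact Near.cons (u := .objective k) hv (Near.cons (u := .agent w) hw
        (Near.cons (u := .constraint i) hw' (Near.cons (u := .agent u) hu hl)))

theorem upperIter_le_of_near [Finite I] [Finite K] (hP : ∀ v, ∃ i, 0 < P.a i v) {s s' : K → ℝ}
    (d : ℕ) (v : V) (h : ∀ k, P.Near (4 * d + 2) (.agent v) (.objective k) → s k ≤ s' k) :
    P.upperIter s' d v ≤ P.upperIter s d v :=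
  upperBound_anti (hP v) fun i u hv hu => lowerIter_le_of_near hP d u fun l hl => h l
    (Near.cons (u := .constraint i) hv (Near.cons (u := .agent u) hu hl))

/-- Lowering targets lowers the lower bounds and raises the upper bounds. Over `n` rounds only
targets within distance `4 * n` have any influence, four edges per round. -/
theorem Consistent.of_near [Finite I] [Finite K] (hP : ∀ v, ∃ i, 0 < P.a i v) {s s' : K → ℝ}
    {n : ℕ} {v : V} (h' : P.Consistent n s' v)
    (h : ∀ k, P.Near (4 * n) (.agent v) (.objective k) → s k ≤ s' k) : P.Consistent n s v :=
  fun d hd => (lowerIter_le_of_near hP _ v fun k hk => h k (hk.mono (by omega))).trans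
    ((h' d hd).trans (upperIter_le_of_near hP _ v fun k hk => h k (hk.mono (by omega))))

theorem continuous_iInf_of_finite {ι X : Type*} [Finite ι] [TopologicalSpace X] {f : ι → X → ℝ}
    (hf : ∀ i, Continuous (f i)) : Continuous fun x => ⨅ i, f i x := by
  cases isEmpty_or_nonempty ι
  · simpa [Real.iInf_of_isEmpty] using continuous_const
  · have := Fintype.ofFinite ι
    simp_rw [← Finset.inf'_univ_eq_ciInf]
    exact Continuous.finset_inf'_apply _ fun i _ => hf i

theorem continuous_iSup_of_finite {ι X : Type*} [Finite ι] [TopologicalSpace X] {f : ι → X → ℝ}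
    (hf : ∀ i, Continuous (f i)) : Continuous fun x => ⨆ i, f i x := by
  cases isEmpty_or_nonempty ι
  · simpa [Real.iSup_of_isEmpty] using continuous_const
  · have := Fintype.ofFinite ι
    simp_rw [← Finset.sup'_univ_eq_ciSup]
    exact Continuous.finset_sup'_apply _ fun i _ => hf i

theorem continuous_upperBound [Finite I] {z : ℝ → V → ℝ} (hz : ∀ v, Continuous fun ω => z ω v)
    (v : V) : Continuous fun ω => P.upperBound (z ω) v :=
  continuous_iInf_of_finite fun _ => by fun_prop

theorem continuous_lowerBound [Finite K] {x : ℝ → V → ℝ} (hx : ∀ v, Continuous fun ω => x ω v)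
    (v : V) : Continuous fun ω => P.lowerBound (fun _ => ω) (x ω) v :=
  continuous_const.max (continuous_iSup_of_finite fun _ => by fun_prop)

theorem continuous_lowerIter [Finite I] [Finite K] :
    ∀ (d : ℕ) (v : V), Continuous fun ω => P.lowerIter (fun _ => ω) d v
  | 0, _ => continuous_const
  | d + 1, v => continuous_lowerBound (continuous_upperBound (continuous_lowerIter d)) v

theorem continuous_upperIter [Finite I] [Finite K] (d : ℕ) (v : V) :
    Continuous fun ω => P.upperIter (fun _ => ω) d v :=
  continuous_upperBound (continuous_lowerIter d) v

theorem isClosed_consistent [Finite I] [Finite K] (n : ℕ) (v : V) :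
    IsClosed {ω : ℝ | P.Consistent n (fun _ => ω) v} := by
  simp only [Consistent, Set.ofPred_forall]
  exact isClosed_iInter fun d => isClosed_iInter fun _ =>
    isClosed_le (continuous_lowerIter _ v) (continuous_upperIter _ v)

theorem Feasible.consistent {y : V → ℝ} (hy : P.Feasible y) (hP : ∀ v, ∃ i, 0 < P.a i v)
    {s : K → ℝ} (hs : ∀ k, s k ≤ ∑ v, P.c k v * y v) (n : ℕ) (v : V) : P.Consistent n s v :=
  fun d _ => ((hy.bounds hP hs (d + 1)).1 v).trans ((hy.bounds hP hs d).2 v)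

theorem feasible_zero : P.Feasible 0 := by
  simp [Feasible]

theorem utility_le [Finite K] (x : V → ℝ) (k : K) : P.utility x ≤ ∑ v, P.c k v * x v :=
  ciInf_le (Set.finite_range _).bddBelow k

/-- Round 0 at one agent `v` of `k` already caps `ω`: the objective forces a first lower bound on
`v`, which consistency keeps below the first upper bound. Rearranged, `ω` is at most the value of
`k` at the first upper bounds, which do not depend on `ω`. -/
theorem bddAbove_targets [Finite K] {n : ℕ} (hn : 0 < n) {k : K} {v : V} (hk : 0 < P.c k v) :
    BddAbove {ω | ∀ v, P.Near (4 * n) (.objective k) (.agent v) →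
      P.Consistent n (fun _ => ω) v} := by
  refine ⟨∑ w, P.c k w * P.upperBound 0 w, fun ω hω => ?_⟩
  have h1 := hω v ((Near.cons (n := 0) (s := .objective k) (u := .agent v) hk (near_zero_iff.2 rfl)).mono (by omega)) 0 hn
  have h2 : _ ≤ P.c k v * P.lowerIter (fun _ => ω) 1 v := le_mul_lowerBound hk
  have h3 := mul_le_mul_of_nonneg_left h1 hk.le
  simp only [upperIter, lowerIter] at *
  linarith

theorem zero_mem_targets (hP : ∀ v, ∃ i, 0 < P.a i v) (n : ℕ) (k : K) :
    (0 : ℝ) ∈ {ω | ∀ v, P.Near (4 * n) (.objective k) (.agent v) →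
      P.Consistent n (fun _ => ω) v} :=
  fun v _ => feasible_zero.consistent hP (by simp) n v

theorem utility_le_localTarget [Finite K] (hP : ∀ v, ∃ i, 0 < P.a i v) {n : ℕ} (hn : 0 < n)
    {k : K} {v : V} (hk : 0 < P.c k v) {y : V → ℝ} (hy : P.Feasible y) :
    P.utility y ≤ P.localTarget n k :=
  le_csSup (bddAbove_targets hn hk) fun v _ => hy.consistent hP (utility_le y) n v

/-- The bounds are continuous in the common target, so the set of admissible targets is closed and
its supremum is attained. -/
theorem consistent_localTarget_of_near [Finite I] [Finite K] (hP : ∀ v, ∃ i, 0 < P.a i v) {n : ℕ}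
    (hn : 0 < n) {k : K} {v : V} (hk : P.Near (4 * n) (.objective k) (.agent v)) :
    P.Consistent n (fun _ => P.localTarget n k) v := by
  -- The walk from `k` to an agent is nonempty, and its first step reaches an agent of `k`; this
  -- gives the boundedness of the targets.
  obtain ⟨w, hw⟩ : ∃ w, 0 < P.c k w := by
    obtain ⟨p, -⟩ := hk
    cases p with
    | cons h p =>
      rename_i t
      cases t with
      | agent w => exact ⟨w, h⟩
      | constraint i => exact absurd h (lt_irrefl _)
      | objective l => exact absurd h (lt_irrefl _)
  refine IsClosed.csSup_mem ?_ ⟨0, zero_mem_targets hP n k⟩ (bddAbove_targets hn hw) v hk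
  simp only [Set.ofPred_forall]
  exact isClosed_iInter fun v => isClosed_iInter fun _ => isClosed_consistent n v

/-- Among the objectives that influence `v`, the one with the largest target has `v` in its own
neighbourhood. Its uniform target is therefore consistent at `v` and dominates all the targets that
`v` can feel. -/
theorem consistent_localTarget [Finite I] [Finite K] (hP : ∀ v, ∃ i, 0 < P.a i v) {n : ℕ}
    (hn : 0 < n) (v : V) : P.Consistent n (P.localTarget n) v := by
  by_cases h : ∃ k, P.Near (4 * n) (.agent v) (.objective k)
  · obtain ⟨k, hk, hmax⟩ := (Set.toFinite {k | P.Near (4 * n) (.agent v) (.objective k)}).exists_maximalFor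
      (P.localTarget n) _ h
    refine (consistent_localTarget_of_near hP hn hk.symm).of_near hP fun l hl => ?_
    exact (le_total _ _).elim id fun h => hmax hl h
  -- No objective is in range, so comparison with the targets 0 is vacuous.
  · exact (feasible_zero.consistent (s := fun _ => 0) hP (by simp) n v).of_near hP
      fun k hk => absurd ⟨k, hk⟩ h

/-! ### Feasibility and approximation ratio of the averaged solution -/

section Solution

variable {ΔI ΔK n : ℕ}

theorem mul_upperIter_le_one [Finite I] {s : K → ℝ} {d : ℕ} {v : V} {i : I} (hi : 0 < P.a i v) :
    P.a i v * P.upperIter s d v ≤ 1 := by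
  have h := mul_upperBound_le (z := P.lowerIter s d) hi
  have h2 : P.a i v * P.lowerIter s d v ≤ ∑ u, P.a i u * P.lowerIter s d u :=
    Finset.single_le_sum (f := fun u => P.a i u * P.lowerIter s d u)
      (fun u _ => mul_nonneg (P.a_nonneg i u) lowerIter_nonneg) (Finset.mem_univ v)
  simp only [upperIter]
  linarith

theorem mul_lowerIter_le_one [Finite I] {s : K → ℝ} {d : ℕ} {v : V} (hs : P.Consistent n s v)
    (hd : d ≤ n) {i : I} (hi : 0 < P.a i v) : P.a i v * P.lowerIter s d v ≤ 1 := by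
  cases d with
  | zero => simp [lowerIter]
  | succ d => exact (mul_le_mul_of_nonneg_left (hs d hd) hi.le).trans (mul_upperIter_le_one hi)

theorem upperIter_nonneg {s : K → ℝ} {d : ℕ} {v : V} (hs : P.Consistent n s v) (hd : d < n) :
    0 ≤ P.upperIter s d v :=
  lowerIter_nonneg.trans (hs d hd)

/-- A weighted sum of values with bounded terms. -/
theorem sum_mul_le_card {w x : V → ℝ} (hw : ∀ u, 0 ≤ w u) {b : V → ℝ}
    (h : ∀ u, 0 < w u → w u * x u ≤ b u) :
    ∑ u, w u * x u ≤ ∑ u with 0 < w u, b u := by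
  classical
  rw [Finset.sum_filter]
  refine Finset.sum_le_sum fun u _ => ?_
  split_ifs with h0
  · exact h u h0
  · simp [le_antisymm (not_lt.1 h0) (hw u)]

theorem sum_filter_mul {w x : V → ℝ} (hw : ∀ u, 0 ≤ w u) :
    ∑ u with 0 < w u, w u * x u = ∑ u, w u * x u := by
  classical
  rw [Finset.sum_filter]
  refine Finset.sum_congr rfl fun u _ => ?_
  split_ifs with h0
  · rfl
  · simp [le_antisymm (not_lt.1 h0) (hw u)]

theorem ncard_eq_card_filter (w : V → ℝ) :
    {u | 0 < w u}.ncard = (Finset.univ.filter fun u => 0 < w u).card := by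
  rw [← Set.ncard_coe_finset]
  simp

theorem sum_lowerIter_le [Finite I] {s : K → ℝ} (hs : ∀ v, P.Consistent n s v) (i : I) {d : ℕ}
    (hd : d ≤ n) : ∑ v, P.a i v * P.lowerIter s d v ≤ {u | 0 < P.a i u}.ncard := by
  refine (sum_mul_le_card (P.a_nonneg i)
    fun u hu => mul_lowerIter_le_one (hs u) hd hu).trans_eq ?_
  simp [ncard_eq_card_filter]

/-- Adding the upper-bound inequalities over the `m` agents gives `X ≤ m - (m - 1) Z`, so `X + Z ≤ m
- (m - 2) Z`, which is at most `m` once `m ≥ 2`. For `m = 1` both `X` and `Z` are at most 1, whence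
the 2 in the maximum. -/
theorem sum_upperIter_add_lowerIter_le [Finite I] {s : K → ℝ} (hs : ∀ v, P.Consistent n s v)
    (i : I) {d : ℕ} (hd : d ≤ n) :
    ∑ v, P.a i v * (P.upperIter s d v + P.lowerIter s d v) ≤
      max 2 ({u | 0 < P.a i u}.ncard : ℝ) := by
  have h := sum_mul_le_card (P.a_nonneg i) (x := P.upperIter s d)
    fun u hu => mul_upperBound_le (z := P.lowerIter s d) hu
  have hz := sum_lowerIter_le hs i hd
  have hz0 : 0 ≤ ∑ v, P.a i v * P.lowerIter s d v :=
    Finset.sum_nonneg fun v _ => mul_nonneg (P.a_nonneg i v) lowerIter_nonneg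
  rw [Finset.sum_add_distrib, sum_filter_mul (P.a_nonneg i), Finset.sum_const,
    ← ncard_eq_card_filter, nsmul_eq_mul] at h
  simp_rw [mul_add, Finset.sum_add_distrib]
  set Z := ∑ v, P.a i v * P.lowerIter s d v
  obtain hm | hm := Nat.lt_or_ge {u | 0 < P.a i u}.ncard 2
  · refine le_max_of_le_left ?_
    interval_cases {u | 0 < P.a i u}.ncard <;> norm_num at * <;> linarith
  · refine le_max_of_le_right ?_
    have : (2 : ℝ) ≤ {u | 0 < P.a i u}.ncard := by exact_mod_cast hm
    nlinarith

theorem feasible_localSolution [Finite I] [Finite K] (hP : ∀ v, ∃ i, 0 < P.a i v) (hn : 0 < n) :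
    P.Feasible (P.localSolution n) := by
  have hs := consistent_localTarget (P := P) hP hn
  set s := P.localTarget n with hsdef
  have hsum : ∀ v, 0 ≤ ∑ d ∈ Finset.range n, (P.upperIter s d v + P.lowerIter s (d + 1) v) :=
    fun v => Finset.sum_nonneg fun d hd =>
      add_nonneg (upperIter_nonneg (hs v) (Finset.mem_range.1 hd)) lowerIter_nonneg
  refine ⟨fun i => ?_, fun v => mul_nonneg (div_nonneg
    (Real.iInf_nonneg fun i => by positivity) (by positivity)) (hsum v)⟩
  set M : ℝ := max 2 ({u | 0 < P.a i u}.ncard : ℝ) with hM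
  have hM0 : 0 < M := by positivity
  have htot : ∑ v, P.a i v * ∑ d ∈ Finset.range n,
      (P.upperIter s d v + P.lowerIter s (d + 1) v) ≤ (n + 1) * M := by
    -- Pairing each upper bound with the lower bound of its own round leaves only the last lower
    -- bound over, because the lower bounds of round 0 vanish.
    have hshift : ∀ v, ∑ d ∈ Finset.range n, (P.upperIter s d v + P.lowerIter s (d + 1) v) =
        ∑ d ∈ Finset.range n, (P.upperIter s d v + P.lowerIter s d v) + P.lowerIter s n v := by
      intro v
      rw [Finset.sum_add_distrib, Finset.sum_add_distrib, add_assoc, ← Finset.sum_range_succ,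
        Finset.sum_range_succ']
      simp [lowerIter]
    simp_rw [hshift, mul_add (P.a i _), Finset.sum_add_distrib (s := Finset.univ), Finset.mul_sum]
    rw [Finset.sum_comm, add_mul, one_mul]
    refine add_le_add ?_ ((sum_lowerIter_le hs i le_rfl).trans (le_max_right _ _))
    refine (Finset.sum_le_card_nsmul _ _ M fun d hd => ?_).trans_eq (by simp)
    exact sum_upperIter_add_lowerIter_le hs i (Finset.mem_range.1 hd).le
  calc ∑ v, P.a i v * P.localSolution n v
      ≤ ∑ v, M⁻¹ / (n + 1) * (P.a i v * ∑ d ∈ Finset.range n,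
          (P.upperIter s d v + P.lowerIter s (d + 1) v)) := by
        refine Finset.sum_le_sum fun v _ => ?_
        rcases (P.a_nonneg i v).eq_or_lt with h0 | h0
        · simp [← h0]
        · rw [mul_left_comm, localSolution]
          have := weight_le h0
          have := hsum v
          gcongr
    _ ≤ M⁻¹ / (n + 1) * ((n + 1) * M) := by
        rw [← Finset.mul_sum]
        gcongr
    _ = 1 := by field_simp

/-- Adding the lower-bound inequalities over the `m` agents of `k` gives `m s ≤ (m - 1) X + Z`. For
`m ≥ 2` this yields `X + Z ≥ s m / (m - 1)`, and `m / (m - 1)` decreases in `m ≤ ΔK`. For `m = 1` it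
says `Z ≥ s`, and consistency `Z ≤ X` supplies the factor 2. -/
theorem le_sum_upperIter_add_lowerIter [Finite K] {s : K → ℝ} (hs : ∀ v, P.Consistent n s v)
    (hP : P.Admissible ΔI ΔK) (hΔK : 2 ≤ ΔK) {k : K} (hk : ∃ v, 0 < P.c k v) {ω : ℝ}
    (hω : 0 ≤ ω) (hωs : ω ≤ s k) {d : ℕ} (hd : d < n) :
    ΔK * ω ≤ (ΔK - 1) * ∑ v, P.c k v * (P.upperIter s d v + P.lowerIter s (d + 1) v) := by
  have h := sum_mul_le_card (P.c_nonneg k) (x := fun v => - P.lowerIter s (d + 1) v)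
    (b := fun v => -(s k - ∑ w, P.c k w * P.upperIter s d w + P.c k v * P.upperIter s d v))
    fun u hu => by
      have := le_mul_lowerBound (s := s) (x := P.upperIter s d) hu
      simp only [lowerIter, upperIter] at *
      linarith
  simp only [mul_neg, Finset.sum_neg_distrib] at h
  rw [Finset.sum_add_distrib, sum_filter_mul (P.c_nonneg k), Finset.sum_const,
    ← ncard_eq_card_filter, nsmul_eq_mul] at h
  simp_rw [mul_add, Finset.sum_add_distrib]
  have hZX : ∑ v, P.c k v * P.lowerIter s (d + 1) v ≤ ∑ v, P.c k v * P.upperIter s d v :=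
    Finset.sum_le_sum fun v _ => mul_le_mul_of_nonneg_left (hs v d hd) (P.c_nonneg k v)
  have hm1 : 1 ≤ {v | 0 < P.c k v}.ncard := (Set.ncard_pos).2 hk
  have hmK : ({v | 0 < P.c k v}.ncard : ℝ) ≤ ΔK := by exact_mod_cast hP.2.2 k
  have hK2 : (2 : ℝ) ≤ ΔK := by exact_mod_cast hΔK
  set X := ∑ v, P.c k v * P.upperIter s d v
  set Z := ∑ v, P.c k v * P.lowerIter s (d + 1) v
  obtain hm | hm := hm1.eq_or_lt
  · rw [← hm] at h
    norm_num at h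
    nlinarith
  · have hm' : (2 : ℝ) ≤ {v | 0 < P.c k v}.ncard := by exact_mod_cast hm
    set m : ℝ := ({v | 0 < P.c k v}.ncard : ℝ)
    have hZ0 : 0 ≤ Z := Finset.sum_nonneg fun v _ => mul_nonneg (P.c_nonneg k v) lowerIter_nonneg
    have h1 : m * ω ≤ (m - 1) * (X + Z) := by
      have h4 : m * ω ≤ m * s k := by gcongr
      have h5 : 0 ≤ (m - 2) * Z := mul_nonneg (by linarith) hZ0
      linarith
    -- In this form the coefficient `m - 1` multiplies a nonnegative quantity, so it can be replaced
    -- by `ΔK - 1`.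
    have h2 : ω ≤ (m - 1) * (X + Z - ω) := by linarith
    have h3 : 0 ≤ X + Z - ω := by
      by_contra! h3
      nlinarith
    nlinarith

theorem utility_le_mul_utility_localSolution [Finite I] [Finite K] (hP : P.Admissible ΔI ΔK)
    (hΔI : 2 ≤ ΔI) (hΔK : 2 ≤ ΔK) (hn : 0 < n) {y : V → ℝ} (hy : P.Feasible y) :
    P.utility y ≤ ΔI * (1 - 1 / ΔK) * (1 + 1 / n) * P.utility (P.localSolution n) := by
  cases isEmpty_or_nonempty K
  · simp [utility, Real.iInf_of_isEmpty]
  have hI2 : (2 : ℝ) ≤ ΔI := by exact_mod_cast hΔI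
  have hK2 : (2 : ℝ) ≤ ΔK := by exact_mod_cast hΔK
  have hn0 : (0 : ℝ) < n := by exact_mod_cast hn
  -- It suffices to examine an objective that attains the minimum.
  obtain ⟨k, hk⟩ := exists_eq_ciInf_of_finite (f := fun k => ∑ v, P.c k v * P.localSolution n v)
  have hs := consistent_localTarget (P := P) hP.1 hn
  have hω : 0 ≤ P.utility y := le_ciInf fun k =>
    Finset.sum_nonneg fun v _ => mul_nonneg (P.c_nonneg k v) (hy.2 v)
  by_cases hv : ∃ v, 0 < P.c k v
  · obtain ⟨v, hkv⟩ := hv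
    have hround := fun d (hd : d < n) => le_sum_upperIter_add_lowerIter hs hP hΔK ⟨v, hkv⟩ hω
      (utility_le_localTarget hP.1 hn hkv hy) hd
    have hall : n * (ΔK * P.utility y) ≤ (ΔK - 1) * ∑ v, P.c k v * ∑ d ∈ Finset.range n,
        (P.upperIter (P.localTarget n) d v + P.lowerIter (P.localTarget n) (d + 1) v) := by
      simp_rw [Finset.mul_sum (Finset.range n)]
      rw [Finset.sum_comm, Finset.mul_sum]
      refine le_trans (le_of_eq (by simp)) (Finset.card_nsmul_le_sum (Finset.range n) _
        (ΔK * P.utility y) fun d hd => hround d (Finset.mem_range.1 hd))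
    have hlow : (ΔI : ℝ)⁻¹ / (n + 1) * ∑ v, P.c k v * ∑ d ∈ Finset.range n,
        (P.upperIter (P.localTarget n) d v + P.lowerIter (P.localTarget n) (d + 1) v) ≤
        ∑ v, P.c k v * P.localSolution n v := by
      rw [Finset.mul_sum]
      refine Finset.sum_le_sum fun v _ => ?_
      rw [mul_left_comm, localSolution]
      have h1 := inv_le_weight hP hΔI v
      have h2 : 0 ≤ ∑ d ∈ Finset.range n,
        (P.upperIter (P.localTarget n) d v + P.lowerIter (P.localTarget n) (d + 1) v) :=
        Finset.sum_nonneg fun d hd =>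
          add_nonneg (upperIter_nonneg (hs v) (Finset.mem_range.1 hd)) lowerIter_nonneg
      have := P.c_nonneg k v
      gcongr
    change _ = P.utility _ at hk
    rw [← hk]
    set S := ∑ v, P.c k v * ∑ d ∈ Finset.range n,
        (P.upperIter (P.localTarget n) d v + P.lowerIter (P.localTarget n) (d + 1) v)
    have hc : (0 : ℝ) ≤ ΔI * (1 - 1 / ΔK) * (1 + 1 / n) := by
      have : (1 : ℝ) / ΔK ≤ 1 := by rw [div_le_one (by linarith)]; linarith
      have : (0 : ℝ) ≤ 1 - 1 / ΔK := by linarith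
      positivity
    refine le_trans ?_ (mul_le_mul_of_nonneg_left hlow hc)
    have : (ΔI : ℝ) * (1 - 1 / ΔK) * (1 + 1 / n) * ((ΔI : ℝ)⁻¹ / (n + 1) * S) =
        (ΔK - 1) * S / (n * ΔK) := by
      field_simp
    rw [this, le_div_iff₀ (by positivity)]
    linarith
  -- An objective without agents forces utility at most 0 on every solution.
  · push Not at hv
    have h0 : ∀ v, P.c k v = 0 := fun v => le_antisymm (hv v) (P.c_nonneg k v)
    have h1 : P.utility (P.localSolution n) = 0 := by
      change _ = P.utility _ at hk
      rw [← hk]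
      simp [h0]
    rw [h1, mul_zero]
    exact (utility_le y k).trans_eq (by simp [h0])

end Solution

end MaxMinLP

/-! ### Equal views determine equal local quantities, across networks -/

namespace Network

variable {L V I K V' I' K' : Type} {N : Network L V I K} {N' : Network L V' I' K'}

theorem localInput_eq_of_view_eq {D : ℕ} {s : Node V I K} {s' : Node V' I' K'}
    (h : N.view D s = N'.view D s') : N.localInput s = N'.localInput s' := by
  cases D with
  | zero => exact h
  | succ D => exact congrArg Prod.fst h

theorem kind_eq_of_view_eq {D : ℕ} {s : Node V I K} {s' : Node V' I' K'}
    (h : N.view D s = N'.view D s') : s.kind = s'.kind := by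
  have h := localInput_eq_of_view_eq h
  cases s <;> cases s' <;> first | rfl | cases h

theorem coeff_eq_of_view_eq {D : ℕ} {s : Node V I K} {s' : Node V' I' K'}
    (h : N.view D s = N'.view D s') (hs : s.kind = .agent) {p : Fin (N.deg s)}
    {p' : Fin (N'.deg s')} (hp : (p : ℕ) = p') :
    N.coeff s (N.nbr s p).1 = N'.coeff s' (N'.nbr s' p').1 := by
  have hk := kind_eq_of_view_eq h
  have h := localInput_eq_of_view_eq h
  cases s <;> cases s' <;> simp only [Node.kind, reduceCtorEq] at hs hk
  simp only [localInput, LocalInput.agent.injEq] at h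
  have := congrArg (fun l : List (NodeKind × ℝ) => (l[(p : ℕ)]?).map Prod.snd) h.2
  have hq : (p' : ℕ) < N.deg (.agent _) := hp ▸ p.2
  obtain rfl : p = ⟨p', hq⟩ := Fin.ext hp
  simpa [List.getElem?_ofFn, hq] using this

/-- Two nodes with the same view have equivalent neighbourhoods. -/
theorem exists_equiv_of_view_eq {D : ℕ} {s : Node V I K} {s' : Node V' I' K'}
    (h : N.view (D + 1) s = N'.view (D + 1) s') :
    ∃ φ : N.graph.neighborSet s ≃ N'.graph.neighborSet s', ∀ t,
      N.view D t.1 = N'.view D (φ t).1 ∧ N.coeff s t.1 = N'.coeff s' (φ t).1 := by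
  have hl := congrArg Prod.snd h
  have hdeg : N.deg s = N'.deg s' := by simpa [view] using congrArg List.length hl
  have hp : ∀ p : Fin (N.deg s), (N.backPort s p : ℕ) = N'.backPort s' (finCongr hdeg p) ∧
      N.view D (N.nbr s p).1 = N'.view D (N'.nbr s' (finCongr hdeg p)).1 := by
    intro p
    have := congrArg (fun l : List (ℕ × View L D) => l[(p : ℕ)]?) hl
    have hp' : (p : ℕ) < N'.deg s' := hdeg ▸ p.2
    simp only [view, List.getElem?_ofFn, p.2, hp', dite_true, Option.some.injEq,
      Prod.mk.injEq] at this
    exact this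
  refine ⟨(N.nbr s).symm.trans ((finCongr hdeg).trans (N'.nbr s')), fun t => ?_⟩
  obtain ⟨p, rfl⟩ := (N.nbr s).surjective t
  simp only [Equiv.trans_apply, Equiv.symm_apply_apply]
  refine ⟨(hp p).2, ?_⟩
  by_cases hs : s.kind = .agent
  · exact coeff_eq_of_view_eq h hs rfl
  -- Only agents know coefficients. From a constraint or an objective, the coefficient is read in
  -- the neighbouring agent's input at the back port recorded in the view.
  · have ht : (N.nbr s p).1.kind = .agent := by
      have := (N.nbr s p).2
      generalize (N.nbr s p).1 = t at this
      change 0 < N.coeff s t at this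
      cases s <;> cases t <;> first | rfl | exact absurd rfl hs | exact absurd this (lt_irrefl _)
    rw [N.coeff_comm, N'.coeff_comm]
    have := coeff_eq_of_view_eq (hp p).2 ht (hp p).1
    simpa [backPort] using this

theorem view_eq_of_le {D D' : ℕ} (hD : D ≤ D') {s : Node V I K} {s' : Node V' I' K'}
    (h : N.view D' s = N'.view D' s') : N.view D s = N'.view D s' := by
  induction D generalizing D' s s' with
  | zero => exact localInput_eq_of_view_eq h
  | succ D ih =>
    obtain ⟨D', rfl⟩ : ∃ n, D' = n + 1 := ⟨D' - 1, by omega⟩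
    have hl := congrArg Prod.snd h
    have hdeg : N.deg s = N'.deg s' := by simpa [view] using congrArg List.length hl
    refine Prod.ext (localInput_eq_of_view_eq h) (List.ext_getElem (by simp [view, hdeg]) fun p hp hp' => ?_)
    have := congrArg (fun l : List (ℕ × View L D') => l[p]?) hl
    simp only [view, List.length_ofFn] at hp hp'
    have hv : (N.backPort s ⟨p, hp⟩ : ℕ) = N'.backPort s' ⟨p, hp'⟩ ∧
        N.view D' (N.nbr s ⟨p, hp⟩).1 = N'.view D' (N'.nbr s' ⟨p, hp'⟩).1 := by
      simpa [view, List.getElem?_ofFn, hp, hp'] using this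
    simpa [view] using ⟨hv.1, ih (by omega) hv.2⟩

/-- Two nodes with the same view have equivalent sets of neighbours of each kind. -/
theorem exists_equiv_of_kind {α α' : Type} {f : α → Node V I K} {f' : α' → Node V' I' K'}
    (κ : NodeKind) (hf : f.Injective) (hf' : f'.Injective) (hκ : ∀ t, t.kind = κ ↔ ∃ x, f x = t)
    (hκ' : ∀ t, t.kind = κ ↔ ∃ x, f' x = t) {D : ℕ} {s : Node V I K} {s' : Node V' I' K'}
    (h : N.view (D + 1) s = N'.view (D + 1) s') :
    ∃ φ : {x // 0 < N.coeff s (f x)} ≃ {x // 0 < N'.coeff s' (f' x)}, ∀ x,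
      N.view D (f x.1) = N'.view D (f' (φ x).1) ∧
        N.coeff s (f x.1) = N'.coeff s' (f' (φ x).1) := by
  obtain ⟨φ, hφ⟩ := exists_equiv_of_view_eq h
  have key : ∀ x : {x // 0 < N.coeff s (f x)}, ∃ x' : {x // 0 < N'.coeff s' (f' x)},
      φ ⟨f x.1, x.2⟩ = ⟨f' x'.1, x'.2⟩ := by
    intro x
    have hk := kind_eq_of_view_eq (hφ ⟨f x.1, x.2⟩).1
    rw [(hκ (f x.1)).2 ⟨_, rfl⟩, eq_comm, hκ'] at hk
    obtain ⟨x', hx'⟩ := hk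
    have := (φ ⟨f x.1, x.2⟩).2
    rw [← hx'] at this
    exact ⟨⟨x', this⟩, Subtype.ext hx'.symm⟩
  choose g hg using key
  refine ⟨Equiv.ofBijective g ⟨fun x y hxy => ?_, fun x' => ?_⟩, fun x => ?_⟩
  · have := hg x
    rw [hxy, ← hg y] at this
    exact Subtype.ext (hf (congrArg Subtype.val (φ.injective this)))
  · obtain ⟨⟨t, ht⟩, hφt⟩ := φ.surjective ⟨f' x'.1, x'.2⟩
    have hk := kind_eq_of_view_eq (hφ ⟨t, ht⟩).1
    rw [hφt, (hκ' _).2 ⟨_, rfl⟩, hκ] at hk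
    obtain ⟨x, rfl⟩ := hk
    exact ⟨⟨x, ht⟩, Subtype.ext (hf' (congrArg Subtype.val ((hg ⟨x, ht⟩).symm.trans hφt)))⟩
  · have := hφ ⟨f x.1, x.2⟩
    rwa [hg x] at this

theorem kind_eq_agent_iff (t : Node V I K) : t.kind = .agent ↔ ∃ v, Node.agent v = t := by
  cases t <;> simp [Node.kind]

theorem kind_eq_constraint_iff (t : Node V I K) :
    t.kind = .constraint ↔ ∃ i, Node.constraint i = t := by
  cases t <;> simp [Node.kind]

theorem kind_eq_objective_iff (t : Node V I K) :
    t.kind = .objective ↔ ∃ k, Node.objective k = t := by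
  cases t <;> simp [Node.kind]

theorem exists_equiv_constraints {D : ℕ} {v : V} {v' : V'}
    (h : N.view (D + 1) (.agent v) = N'.view (D + 1) (.agent v')) :
    ∃ φ : {i // 0 < N.a i v} ≃ {i // 0 < N'.a i v'}, ∀ i,
      N.view D (.constraint i.1) = N'.view D (.constraint (φ i).1) ∧
        N.a i.1 v = N'.a (φ i).1 v' :=
  exists_equiv_of_kind .constraint (fun _ _ => Node.constraint.inj)
    (fun _ _ => Node.constraint.inj) kind_eq_constraint_iff kind_eq_constraint_iff h

theorem exists_equiv_objectives {D : ℕ} {v : V} {v' : V'}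
    (h : N.view (D + 1) (.agent v) = N'.view (D + 1) (.agent v')) :
    ∃ φ : {k // 0 < N.c k v} ≃ {k // 0 < N'.c k v'}, ∀ k,
      N.view D (.objective k.1) = N'.view D (.objective (φ k).1) ∧
        N.c k.1 v = N'.c (φ k).1 v' :=
  exists_equiv_of_kind .objective (fun _ _ => Node.objective.inj)
    (fun _ _ => Node.objective.inj) kind_eq_objective_iff kind_eq_objective_iff h

theorem exists_equiv_agents_of_constraint {D : ℕ} {i : I} {i' : I'}
    (h : N.view (D + 1) (.constraint i) = N'.view (D + 1) (.constraint i')) :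
    ∃ φ : {v // 0 < N.a i v} ≃ {v // 0 < N'.a i' v}, ∀ v,
      N.view D (.agent v.1) = N'.view D (.agent (φ v).1) ∧ N.a i v.1 = N'.a i' (φ v).1 :=
  exists_equiv_of_kind .agent (fun _ _ => Node.agent.inj)
    (fun _ _ => Node.agent.inj) kind_eq_agent_iff kind_eq_agent_iff h

theorem exists_equiv_agents_of_objective {D : ℕ} {k : K} {k' : K'}
    (h : N.view (D + 1) (.objective k) = N'.view (D + 1) (.objective k')) :
    ∃ φ : {v // 0 < N.c k v} ≃ {v // 0 < N'.c k' v}, ∀ v,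
      N.view D (.agent v.1) = N'.view D (.agent (φ v).1) ∧ N.c k v.1 = N'.c k' (φ v).1 :=
  exists_equiv_of_kind .agent (fun _ _ => Node.agent.inj)
    (fun _ _ => Node.agent.inj) kind_eq_agent_iff kind_eq_agent_iff h

/-- A view of radius `m + r` contains the radius-`r` views of all nodes within distance `m`, so it
decides every statement about them that depends on those views alone. -/
theorem forall_near_iff_of_view_eq {r : ℕ} {p : V → Prop} {p' : V' → Prop}
    (hp : ∀ v v', N.view r (.agent v) = N'.view r (.agent v') → (p v ↔ p' v')) (m : ℕ) :
    ∀ {s : Node V I K} {s' : Node V' I' K'}, N.view (m + r) s = N'.view (m + r) s' →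
      ((∀ v, N.Near m s (.agent v) → p v) ↔ ∀ v, N'.Near m s' (.agent v) → p' v) := by
  induction m with
  | zero =>
    intro s s' h
    have hk := kind_eq_of_view_eq h
    simp only [MaxMinLP.near_zero_iff]
    cases s <;> cases s' <;> simp only [Node.kind, reduceCtorEq] at hk
    · simpa using hp _ _ (view_eq_of_le (by omega) h)
    · simp
    · simp
  | succ m ih =>
    intro s s' h
    rw [Nat.add_right_comm] at h
    obtain ⟨φ, hφ⟩ := exists_equiv_of_view_eq h
    simp only [MaxMinLP.near_succ_iff, or_imp, forall_and, forall_exists_index]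
    rw [ih (view_eq_of_le (by omega) h), forall_comm, forall_comm (α := V')]
    exact and_congr_right fun _ => φ.forall_congr fun t => ih (hφ t).1

theorem weight_eq_of_view_eq {v : V} {v' : V'}
    (h : N.view 2 (.agent v) = N'.view 2 (.agent v')) : N.weight v = N'.weight v' := by
  obtain ⟨φ, hφ⟩ := exists_equiv_constraints h
  refine Equiv.iInf_congr φ fun i => ?_
  obtain ⟨ψ, -⟩ := exists_equiv_agents_of_constraint (hφ i).1
  rw [show {u | 0 < N'.a (φ i).1 u}.ncard = {u | 0 < N.a i.1 u}.ncard from Nat.card_congr ψ.symm]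

section Local

variable [Fintype V] [Fintype V']

/-- Weighted sums over equivalent supports agree. -/
theorem sum_mul_eq_of_equiv {w x : V → ℝ} {w' x' : V' → ℝ} (hw : ∀ v, 0 ≤ w v)
    (hw' : ∀ v, 0 ≤ w' v) (φ : {v // 0 < w v} ≃ {v // 0 < w' v})
    (h : ∀ v, w v.1 = w' (φ v).1 ∧ x v.1 = x' (φ v).1) :
    ∑ v, w v * x v = ∑ v, w' v * x' v := by
  classical
  rw [← MaxMinLP.sum_filter_mul hw, ← MaxMinLP.sum_filter_mul hw',
    Finset.sum_subtype (p := fun v => 0 < w v) _ (by simp),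
    Finset.sum_subtype (p := fun v => 0 < w' v) _ (by simp)]
  exact Fintype.sum_equiv φ _ _ fun v => by rw [(h v).1, (h v).2]

theorem upperBound_eq_of_view_eq {D : ℕ} {z : V → ℝ} {z' : V' → ℝ}
    (hz : ∀ v v', N.view D (.agent v) = N'.view D (.agent v') → z v = z' v') {v : V} {v' : V'}
    (h : N.view (D + 2) (.agent v) = N'.view (D + 2) (.agent v')) :
    N.upperBound z v = N'.upperBound z' v' := by
  obtain ⟨φ, hφ⟩ := exists_equiv_constraints h
  refine Equiv.iInf_congr φ fun i => ?_
  obtain ⟨ψ, hψ⟩ := exists_equiv_agents_of_constraint (hφ i).1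
  rw [← (hφ i).2, hz v v' (view_eq_of_le (by omega) h),
    sum_mul_eq_of_equiv (N.a_nonneg _) (N'.a_nonneg _) ψ fun u =>
      ⟨(hψ u).2, hz _ _ (hψ u).1⟩]

theorem lowerBound_eq_of_view_eq {D r : ℕ} {s : K → ℝ} {s' : K' → ℝ} {x : V → ℝ} {x' : V' → ℝ}
    (hs : ∀ k k', N.view r (.objective k) = N'.view r (.objective k') → s k = s' k')
    (hr : r ≤ D + 1)
    (hx : ∀ v v', N.view D (.agent v) = N'.view D (.agent v') → x v = x' v') {v : V} {v' : V'}
    (h : N.view (D + 2) (.agent v) = N'.view (D + 2) (.agent v')) :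
    N.lowerBound s x v = N'.lowerBound s' x' v' := by
  obtain ⟨φ, hφ⟩ := exists_equiv_objectives h
  refine congrArg (max 0) (Equiv.iSup_congr φ fun k => ?_)
  obtain ⟨ψ, hψ⟩ := exists_equiv_agents_of_objective (hφ k).1
  rw [← (hφ k).2, hx v v' (view_eq_of_le (by omega) h),
    hs _ _ (view_eq_of_le hr (hφ k).1),
    sum_mul_eq_of_equiv (N.c_nonneg _) (N'.c_nonneg _) ψ fun u =>
      ⟨(hψ u).2, hx _ _ (hψ u).1⟩]

/-- One round travels agent, objective, agent, constraint, agent: four edges. The summand `r` is the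
radius at which objectives know their targets. -/
theorem lowerIter_eq_of_view_eq {r : ℕ} {s : K → ℝ} {s' : K' → ℝ}
    (hs : ∀ k k', N.view r (.objective k) = N'.view r (.objective k') → s k = s' k') (d : ℕ) :
    ∀ {v : V} {v' : V'},
      N.view (4 * d + r) (.agent v) = N'.view (4 * d + r) (.agent v') →
      N.lowerIter s d v = N'.lowerIter s' d v' := by
  induction d with
  | zero => exact fun _ => rfl
  | succ d ih =>
    intro v v' h
    refine lowerBound_eq_of_view_eq (D := 4 * d + r + 2) hs (by omega)
      (fun w w' hw => upperBound_eq_of_view_eq (fun u u' hu => ih hu) hw)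
      (view_eq_of_le (by omega) h)

theorem upperIter_eq_of_view_eq {r : ℕ} {s : K → ℝ} {s' : K' → ℝ}
    (hs : ∀ k k', N.view r (.objective k) = N'.view r (.objective k') → s k = s' k') (d : ℕ)
    {v : V} {v' : V'}
    (h : N.view (4 * d + r + 2) (.agent v) = N'.view (4 * d + r + 2) (.agent v')) :
    N.upperIter s d v = N'.upperIter s' d v' :=
  upperBound_eq_of_view_eq (fun _ _ hu => lowerIter_eq_of_view_eq hs d hu) h

theorem consistent_iff_of_view_eq {n : ℕ} {ω : ℝ} {v : V} {v' : V'}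
    (h : N.view (4 * n) (.agent v) = N'.view (4 * n) (.agent v')) :
    N.Consistent n (fun _ => ω) v ↔ N'.Consistent n (fun _ => ω) v' := by
  refine forall₂_congr fun d hd => ?_
  rw [lowerIter_eq_of_view_eq (r := 0) (s' := fun _ => ω) (fun _ _ _ => rfl) (d + 1)
      (view_eq_of_le (by omega) h),
    upperIter_eq_of_view_eq (r := 0) (s' := fun _ => ω) (fun _ _ _ => rfl) d
      (view_eq_of_le (by omega) h)]

/-- The radius is `4 * n` for the neighbourhood of `k` plus `4 * n` for consistency at each of its
agents. -/
theorem localTarget_eq_of_view_eq {n : ℕ} {k : K} {k' : K'}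
    (h : N.view (8 * n) (.objective k) = N'.view (8 * n) (.objective k')) :
    N.localTarget n k = N'.localTarget n k' :=
  congrArg sSup (Set.ext fun _ => forall_near_iff_of_view_eq
    (fun _ _ hv => consistent_iff_of_view_eq hv) (4 * n) (view_eq_of_le (by omega) h))

/-- The targets need radius `8 * n` and the `n` rounds another `4 * n`. The summand 2 covers the
weight even when `n = 0`. -/
theorem localSolution_eq_of_view_eq {n : ℕ} {v : V} {v' : V'}
    (h : N.view (12 * n + 2) (.agent v) = N'.view (12 * n + 2) (.agent v')) :
    N.localSolution n v = N'.localSolution n v' := by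
  have hs : ∀ k k', N.view (8 * n) (.objective k) = N'.view (8 * n) (.objective k') →
      N.localTarget n k = N'.localTarget n k' := fun k k' => localTarget_eq_of_view_eq
  rw [MaxMinLP.localSolution, MaxMinLP.localSolution,
    weight_eq_of_view_eq (view_eq_of_le (by omega) h)]
  congr 1
  refine Finset.sum_congr rfl fun d hd => ?_
  rw [Finset.mem_range] at hd
  rw [upperIter_eq_of_view_eq hs d (view_eq_of_le (by omega) h),
    lowerIter_eq_of_view_eq hs (d + 1) (view_eq_of_le (by omega) h)]

end Local

end Network

/-! ### The local algorithm and its ratio -/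

namespace LocalAlgorithm

/-- The averaged solution over `n` rounds is computed by a local algorithm. -/
theorem exists_output_eq_localSolution (L : Type) {n D : ℕ} (hD : 12 * n + 2 ≤ D) :
    ∃ 𝒜 : LocalAlgorithm L D, ∀ (V I K : Type) [Fintype V] (N : Network L V I K),
      𝒜.output N = N.localSolution n := by
  classical
  -- On a view that occurs in some network, the algorithm returns the value of the averaged solution
  -- in any such network; by locality the choice does not matter.
  refine ⟨fun w => if h : ∃ x : ℝ, ∃ (V I K : Type) (_ : Fintype V) (N : Network L V I K) (v : V),
    N.view D (.agent v) = w ∧ N.localSolution n v = x then h.choose else 0, ?_⟩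
  intro V I K _ N
  funext v
  have h : ∃ x : ℝ, ∃ (V I K : Type) (_ : Fintype V) (N' : Network L V I K) (v' : V),
    N'.view D (.agent v') = N.view D (.agent v) ∧ N'.localSolution n v' = x :=
    ⟨_, V, I, K, inferInstance, N, v, rfl, rfl⟩
  refine (dif_pos h).trans ?_
  obtain ⟨V', I', K', _, N', v', hv, hx⟩ := h.choose_spec
  rw [← hx]
  exact Network.localSolution_eq_of_view_eq (Network.view_eq_of_le hD hv)

theorem exists_hasRatio {R : ℕ} (hR : 2 ≤ R) :
    ∃ 𝒜 : LocalAlgorithm Unit (12 * R), ∀ ΔI ΔK : ℕ, 2 ≤ ΔI → 2 ≤ ΔK →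
      𝒜.HasRatio ΔI ΔK ((ΔI : ℝ) * (1 - 1 / (ΔK : ℝ)) * (1 + 1 / ((R : ℝ) - 1))) := by
  obtain ⟨n, rfl⟩ : ∃ n, R = n + 1 := ⟨R - 1, by omega⟩
  obtain ⟨𝒜, h𝒜⟩ := exists_output_eq_localSolution Unit (n := n) (D := 12 * (n + 1)) (by omega)
  refine ⟨𝒜, fun ΔI ΔK hΔI hΔK V I K _ _ _ N hN => ?_⟩
  rw [ApproximatesOn, h𝒜]
  have hn : 0 < n := by omega
  refine ⟨MaxMinLP.feasible_localSolution hN.1 hn, fun y hy => ?_⟩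
  have := MaxMinLP.utility_le_mul_utility_localSolution hN hΔI hΔK hn hy
  simpa using this

theorem HasRatio.mono {D : ℕ} {𝒜 : LocalAlgorithm Unit D} {ΔI ΔK : ℕ} {α β : ℝ}
    (h : 𝒜.HasRatio ΔI ΔK α) (hαβ : α ≤ β) : 𝒜.HasRatio ΔI ΔK β := by
  intro V I K _ _ _ N hN
  have h := h V I K N hN
  refine ⟨h.1, fun y hy => (h.2 y hy).trans (mul_le_mul_of_nonneg_right hαβ ?_)⟩
  exact Real.iInf_nonneg fun k =>
    Finset.sum_nonneg fun v _ => mul_nonneg (N.c_nonneg k v) (h.1.2 v)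

theorem exists_hasRatio_add {ΔI ΔK : ℕ} (hΔI : 2 ≤ ΔI) (hΔK : 2 ≤ ΔK) {ε : ℝ} (hε : 0 < ε) :
    ∃ (D : ℕ) (𝒜 : LocalAlgorithm Unit D),
      𝒜.HasRatio ΔI ΔK ((ΔI : ℝ) * (1 - 1 / (ΔK : ℝ)) + ε) := by
  -- With `R = n + 2` the excess over the leading factor `C` is `C / (n + 1)`, which is below `ε`
  -- once `n > C / ε`.
  obtain ⟨n, hn⟩ := exists_nat_gt ((ΔI : ℝ) * (1 - 1 / (ΔK : ℝ)) / ε)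
  obtain ⟨𝒜, h𝒜⟩ := exists_hasRatio (R := n + 2) (by omega)
  refine ⟨_, 𝒜, (h𝒜 ΔI ΔK hΔI hΔK).mono ?_⟩
  rw [div_lt_iff₀ hε] at hn
  rw [mul_add, mul_one, mul_one_div]
  gcongr
  push_cast
  have hn0 : (0 : ℝ) < n + 2 - 1 := by
    have : (0 : ℝ) ≤ n := n.cast_nonneg
    linarith
  rw [div_le_iff₀ hn0]
  nlinarith

end LocalAlgorithm

/-! ### Tools for the lower bound: word length in free groups, networks from neighbour lists -/

theorem List.idxOf_map_of_injective {α β : Type*} [DecidableEq α] [DecidableEq β] {f : α → β}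
    (hf : f.Injective) (a : α) (l : List α) : (l.map f).idxOf (f a) = l.idxOf a := by
  induction l with
  | nil => rfl
  | cons b l ih =>
    by_cases h : b = a
    · subst h; simp
    · rw [List.map_cons, List.idxOf_cons_ne _ h, List.idxOf_cons_ne _ (hf.ne h), ih]

namespace FreeGroup

variable {α : Type*} [DecidableEq α]

/-- Multiplication by a letter changes the length of an element of a free group by one, and only
one letter decreases it. -/
theorem norm_mk_singleton_mul (x : α × Bool) (g : FreeGroup α) :
    (mk [x] * g).norm = g.norm + 1 ∨
      (mk [x] * g).norm + 1 = g.norm ∧ g.toWord.head? = some (x.1, !x.2) := by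
  have h : (mk [x] * g).toWord = reduce (x :: g.toWord) := by
    conv_lhs => rw [← mk_toWord (x := g), mul_mk, toWord_mk]
    rfl
  rw [reduce.cons, reduce_toWord] at h
  unfold norm
  rw [h]
  cases g.toWord with
  | nil => simp
  | cons y l =>
    by_cases hxy : x.1 = y.1 ∧ x.2 = !y.2
    · right
      simp [hxy]
    · left
      simp [hxy]

theorem norm_of_mul (a : α) (g : FreeGroup α) :
    (of a * g).norm = g.norm + 1 ∨
      (of a * g).norm + 1 = g.norm ∧ g.toWord.head? = some (a, false) :=
  norm_mk_singleton_mul (a, true) g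

theorem norm_inv_of_mul (a : α) (g : FreeGroup α) :
    ((of a)⁻¹ * g).norm = g.norm + 1 ∨
      ((of a)⁻¹ * g).norm + 1 = g.norm ∧ g.toWord.head? = some (a, true) :=
  norm_mk_singleton_mul (a, false) g

theorem finite_norm_le [Finite α] (n : ℕ) : {g : FreeGroup α | g.norm ≤ n}.Finite :=
  (List.finite_length_le (α × Bool) n).preimage toWord_injective.injOn

instance [Finite α] (n : ℕ) : Finite {g : FreeGroup α // g.norm ≤ n} :=
  (finite_norm_le n).to_subtype

end FreeGroup

namespace Node

variable {V I K V' I' K' : Type}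

/-- The map on nodes given by maps on agents, constraints and objectives. -/
def map (f : V → V') (g : I → I') (h : K → K') : Node V I K → Node V' I' K'
  | .agent v => .agent (f v)
  | .constraint i => .constraint (g i)
  | .objective k => .objective (h k)

theorem map_injective {f : V → V'} {g : I → I'} {h : K → K'} (hf : f.Injective)
    (hg : g.Injective) (hh : h.Injective) : (map f g h).Injective := by
  intro s t hst
  cases s <;> cases t <;> simp_all [map, hf.eq_iff, hg.eq_iff, hh.eq_iff]

instance [Finite V] [Finite I] [Finite K] : Finite (Node V I K) :=
  Finite.of_surjective (fun x : V ⊕ I ⊕ K => match x with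
    | .inl v => Node.agent v
    | .inr (.inl i) => .constraint i
    | .inr (.inr k) => .objective k) fun s => match s with
    | .agent v => ⟨.inl v, rfl⟩
    | .constraint i => ⟨.inr (.inl i), rfl⟩
    | .objective k => ⟨.inr (.inr k), rfl⟩

end Node

namespace Network

open Classical in
/-- The network whose port numbering is given by lists of the neighbours of the nodes. -/
noncomputable def ofLists {L V I K : Type} (P : MaxMinLP V I K)
    (nb : Node V I K → List (Node V I K)) (hnd : ∀ s, (nb s).Nodup)
    (hmem : ∀ s t, t ∈ nb s ↔ 0 < P.coeff s t) (label : Node V I K → L) : Network L V I K where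
  toMaxMinLP := P
  deg s := (nb s).length
  nbr s := ((hnd s).getEquiv (nb s)).trans (Equiv.subtypeEquivRight fun t => hmem s t)
  label := label

section OfLists

variable {L V I K : Type} {P : MaxMinLP V I K} {nb : Node V I K → List (Node V I K)}
  {hnd : ∀ s, (nb s).Nodup} {hmem : ∀ s t, t ∈ nb s ↔ 0 < P.coeff s t} {label : Node V I K → L}

theorem localInput_ofLists_agent (v : V) :
    (ofLists P nb hnd hmem label).localInput (.agent v) = .agent (label (.agent v))
      ((nb (.agent v)).map fun t => (t.kind, P.coeff (.agent v) t)) := by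
  refine congrArg (LocalInput.agent _) ?_
  conv_rhs => rw [← List.ofFn_get (nb (.agent v)), List.map_ofFn]
  rfl

open Classical in
theorem view_ofLists_succ (D : ℕ) (s : Node V I K) :
    (ofLists P nb hnd hmem label).view (D + 1) s =
      ((ofLists P nb hnd hmem label).localInput s, (nb s).map fun t =>
        ((nb t).idxOf s, (ofLists P nb hnd hmem label).view D t)) := by
  refine congrArg (Prod.mk _) ?_
  conv_rhs => rw [← List.ofFn_get (nb s), List.map_ofFn]
  rfl

end OfLists

end Network

/-! ### The infinite network, its symmetries and its finite truncation -/

namespace TreeNetwork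

open FreeGroup

/-- The nodes of the infinite network in which every constraint has `p` agents and every objective
has `q` agents, whose connected components are trees. -/
abbrev InfNode (p q : ℕ) : Type :=
  Node ((Fin p × Fin q) × FreeGroup (Fin p × Fin q)) (Fin q × FreeGroup (Fin p × Fin q))
    (Fin p × FreeGroup (Fin p × Fin q))

variable {p q : ℕ}

/-- The neighbours of a node in the infinite network. -/
def infNb : InfNode p q → List (InfNode p q)
  | .agent (e, g) => [.constraint (e.2, g), .objective (e.1, of e * g)]
  | .constraint (r, g) => (List.finRange p).map fun i => .agent ((i, r), g)
  | .objective (i, h) => (List.finRange q).map fun r => .agent ((i, r), (of (i, r))⁻¹ * h)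

/-- The norm of the group element of a node. -/
def size : InfNode p q → ℕ
  | .agent (_, g) => g.norm
  | .constraint (_, g) => g.norm
  | .objective (_, h) => h.norm

/-- The automorphism of the infinite network given by right multiplication. -/
def shift (γ : FreeGroup (Fin p × Fin q)) : InfNode p q → InfNode p q :=
  Node.map (Prod.map id (· * γ)) (Prod.map id (· * γ)) (Prod.map id (· * γ))

theorem shift_injective (γ : FreeGroup (Fin p × Fin q)) : (shift γ).Injective := by
  have (α : Type) : (Prod.map (id : α → α) (· * γ)).Injective :=
    Function.injective_id.prodMap (mul_left_injective γ)
  exact Node.map_injective (this _) (this _) (this _)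

theorem size_shift_le (γ : FreeGroup (Fin p × Fin q)) (s : InfNode p q) :
    size (shift γ s) ≤ size s + γ.norm := by
  rcases s with ⟨e, g⟩ | ⟨r, g⟩ | ⟨i, g⟩ <;> exact FreeGroup.norm_mul_le g γ

/-- Edges come from left multiplications, which commute with right multiplications. Equality of the
ordered lists means that the port numbers are preserved as well. -/
theorem infNb_shift (γ : FreeGroup (Fin p × Fin q)) (s : InfNode p q) :
    infNb (shift γ s) = (infNb s).map (shift γ) := by
  rcases s with ⟨e, g⟩ | ⟨r, g⟩ | ⟨i, g⟩ <;> simp [infNb, shift, Node.map, mul_assoc]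

theorem size_le_of_mem_infNb {s t : InfNode p q} (h : t ∈ infNb s) : size t ≤ size s + 1 := by
  rcases s with ⟨e, g⟩ | ⟨r, g⟩ | ⟨i, g⟩
  · simp only [infNb, List.mem_cons, List.not_mem_nil, or_false] at h
    rcases h with rfl | rfl
    · exact Nat.le_succ _
    · exact (FreeGroup.norm_mul_le _ _).trans (by rw [norm_of, size, add_comm])
  · obtain ⟨i, -, rfl⟩ := List.mem_map.1 h
    exact Nat.le_succ _
  · obtain ⟨r, -, rfl⟩ := List.mem_map.1 h
    exact (FreeGroup.norm_mul_le _ _).trans (by rw [norm_inv_eq, norm_of, size, add_comm])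

/-- The local inputs in the infinite network with labels `ℓ`. -/
noncomputable def infInput (ℓ : InfNode p q → ℕ) : InfNode p q → LocalInput ℕ
  | .agent x => .agent (ℓ (.agent x)) [(.constraint, 1), (.objective, 1)]
  | .constraint x => .constraint (ℓ (.constraint x)) p
  | .objective x => .objective (ℓ (.objective x)) q

open Classical in
/-- The local views in the infinite network with labels `ℓ`. -/
noncomputable def infView (ℓ : InfNode p q → ℕ) : (D : ℕ) → InfNode p q → View ℕ D
  | 0, s => infInput ℓ s
  | D + 1, s => (infInput ℓ s, (infNb s).map fun t => ((infNb t).idxOf s, infView ℓ D t))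

theorem infInput_comp_shift (ℓ : InfNode p q → ℕ) (γ : FreeGroup (Fin p × Fin q))
    (s : InfNode p q) : infInput (ℓ ∘ shift γ) s = infInput ℓ (shift γ s) := by
  cases s <;> rfl

theorem infView_comp_shift (ℓ : InfNode p q → ℕ) (γ : FreeGroup (Fin p × Fin q)) (D : ℕ)
    (s : InfNode p q) : infView (ℓ ∘ shift γ) D s = infView ℓ D (shift γ s) := by
  classical
  induction D generalizing s with
  | zero => exact infInput_comp_shift ℓ γ s
  | succ D ih =>
    refine Prod.ext (infInput_comp_shift ℓ γ s) ?_
    simp only [infView, infNb_shift, List.map_map]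
    refine List.map_congr_left fun t _ => Prod.ext ?_ (ih t)
    simp only [Function.comp_apply, infNb_shift]
    convert (List.idxOf_map_of_injective (shift_injective γ) _ _).symm

theorem infInput_congr {ℓ ℓ' : InfNode p q → ℕ} {s : InfNode p q} (h : ℓ s = ℓ' s) :
    infInput ℓ s = infInput ℓ' s := by
  cases s <;> simp [infInput, h]

/-- Each edge increases the size by at most one, so a view of radius `D` reads no label beyond size
`size s + D`. -/
theorem infView_congr {ℓ ℓ' : InfNode p q → ℕ} {D : ℕ} {s : InfNode p q}
    (h : ∀ t, size t ≤ size s + D → ℓ t = ℓ' t) : infView ℓ D s = infView ℓ' D s := by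
  induction D generalizing s with
  | zero => exact infInput_congr (h s le_rfl)
  | succ D ih =>
    refine Prod.ext (infInput_congr (h s (by omega))) ?_
    refine List.map_congr_left fun t ht => Prod.ext rfl (ih fun u hu => h u ?_)
    have := size_le_of_mem_infNb ht
    omega

/-- The elements of norm at most `n`. -/
abbrev Ball (p q n : ℕ) : Type := {g : FreeGroup (Fin p × Fin q) // g.norm ≤ n}

/-- The agents of the truncated network. -/
abbrev Agent (p q n : ℕ) : Type := (Fin p × Fin q) × Ball p q (n + 1)

/-- The constraints of the truncated network. -/
abbrev Constr (p q n : ℕ) : Type := Fin q × Ball p q (n + 1)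

/-- The objectives of the truncated network. -/
abbrev Objective (p q n : ℕ) : Type := Fin p × Ball p q n

variable {n : ℕ}

/-- The max-min LP of the truncated network. -/
noncomputable def lp (p q n : ℕ) : MaxMinLP (Agent p q n) (Constr p q n) (Objective p q n) where
  a i v := if v.1.2 = i.1 ∧ v.2 = i.2 then 1 else 0
  c k v := if v.1.1 = k.1 ∧ of v.1 * v.2.1 = k.2.1 then 1 else 0
  a_nonneg i v := by split_ifs <;> norm_num
  c_nonneg k v := by split_ifs <;> norm_num

/-- The agent of the objective `k` towards the constraints of type `r`. -/
def agentOf (k : Objective p q n) (r : Fin q) : Agent p q n :=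
  ((k.1, r), ⟨(of (k.1, r))⁻¹ * k.2.1, (FreeGroup.norm_mul_le _ _).trans (by
    rw [norm_inv_eq, norm_of, add_comm]; exact Nat.succ_le_succ k.2.2)⟩)

theorem a_pos_iff {i : Constr p q n} {v : Agent p q n} :
    0 < (lp p q n).a i v ↔ v.1.2 = i.1 ∧ v.2 = i.2 := by
  simp only [lp]
  split_ifs with h <;> simp [h]

theorem c_pos_iff {k : Objective p q n} {v : Agent p q n} :
    0 < (lp p q n).c k v ↔ v.1.1 = k.1 ∧ of v.1 * v.2.1 = k.2.1 := by
  simp only [lp]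
  split_ifs with h <;> simp [h]

theorem c_pos_iff_exists {k : Objective p q n} {v : Agent p q n} :
    0 < (lp p q n).c k v ↔ ∃ r, agentOf k r = v := by
  rw [c_pos_iff]
  constructor
  · rintro ⟨h1, h2⟩
    obtain ⟨⟨i, r⟩, g, hg⟩ := v
    obtain ⟨i', h, hh⟩ := k
    simp only at h1 h2
    subst h1 h2
    exact ⟨r, by simp [agentOf]⟩
  · rintro ⟨r, rfl⟩
    simp [agentOf]

/-- The neighbours of a node in the truncated network. -/
def nb : Node (Agent p q n) (Constr p q n) (Objective p q n) →
    List (Node (Agent p q n) (Constr p q n) (Objective p q n))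
  | .agent (e, g) => .constraint (e.2, g) ::
      -- Objectives stop one level before agents and constraints: boundary agents may lose their
      -- objective, but every objective keeps all its `q` agents.
      if h : (of e * g.1).norm ≤ n then [.objective (e.1, ⟨of e * g.1, h⟩)] else []
  | .constraint (r, g) => (List.finRange p).map fun i => .agent ((i, r), g)
  | .objective k => (List.finRange q).map fun r => .agent (agentOf k r)

theorem nodup_nb (s : Node (Agent p q n) (Constr p q n) (Objective p q n)) : (nb s).Nodup := by
  rcases s with ⟨e, g⟩ | ⟨r, g⟩ | k
  · simp only [nb]
    split_ifs <;> simp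
  · exact (List.nodup_finRange p).map fun i j h => by simpa using h
  · exact (List.nodup_finRange q).map fun i j h => by
      simp only [agentOf, Node.agent.injEq, Prod.mk.injEq] at h
      exact h.1.2

theorem mem_nb_iff (s t : Node (Agent p q n) (Constr p q n) (Objective p q n)) :
    t ∈ nb s ↔ 0 < (lp p q n).coeff s t := by
  rcases s with ⟨e, g⟩ | ⟨r, g⟩ | k
  · rcases t with v | ⟨r, g'⟩ | ⟨i, h⟩
    · simp only [nb, MaxMinLP.coeff, lt_irrefl]
      split_ifs <;> simp
    · simp only [nb, MaxMinLP.coeff, a_pos_iff]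
      split_ifs <;> simp [eq_comm]
    · simp only [nb, MaxMinLP.coeff, c_pos_iff]
      split_ifs with hn
      · simp [eq_comm, Subtype.ext_iff]
      · simp only [List.mem_cons, reduceCtorEq, List.not_mem_nil, or_self, false_iff]
        rintro ⟨-, h'⟩
        exact hn (h' ▸ h.2)
  · rcases t with ⟨⟨i, r'⟩, g'⟩ | i | k
    · simp [nb, MaxMinLP.coeff, a_pos_iff, eq_comm]
    · simp [nb, MaxMinLP.coeff]
    · simp [nb, MaxMinLP.coeff]
  · rcases t with v | i | k
    · simp [nb, MaxMinLP.coeff, c_pos_iff_exists]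
    · simp [nb, MaxMinLP.coeff]
    · simp [nb, MaxMinLP.coeff]

/-- The truncated network with labels `ℓ`. -/
noncomputable def network (p q n : ℕ)
    (ℓ : Node (Agent p q n) (Constr p q n) (Objective p q n) → ℕ) :
    Network ℕ (Agent p q n) (Constr p q n) (Objective p q n) :=
  .ofLists (lp p q n) nb nodup_nb mem_nb_iff ℓ

/-- The embedding of the truncated network into the infinite network. -/
def emb : Node (Agent p q n) (Constr p q n) (Objective p q n) → InfNode p q :=
  Node.map (Prod.map id Subtype.val) (Prod.map id Subtype.val) (Prod.map id Subtype.val)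

theorem emb_injective : (emb (p := p) (q := q) (n := n)).Injective := by
  have (α : Type) (m : ℕ) : (Prod.map (id : α → α) (Subtype.val : Ball p q m → _)).Injective :=
    Function.injective_id.prodMap Subtype.val_injective
  exact Node.map_injective (this _ _) (this _ _) (this _ _)

theorem exists_emb_eq {s : InfNode p q} (hs : size s ≤ n) :
    ∃ t : Node (Agent p q n) (Constr p q n) (Objective p q n), emb t = s := by
  rcases s with ⟨e, g⟩ | ⟨r, g⟩ | ⟨i, g⟩
  · exact ⟨.agent (e, ⟨g, Nat.le_succ_of_le hs⟩), rfl⟩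
  · exact ⟨.constraint (r, ⟨g, Nat.le_succ_of_le hs⟩), rfl⟩
  · exact ⟨.objective (i, ⟨g, hs⟩), rfl⟩

theorem infNb_emb {s : Node (Agent p q n) (Constr p q n) (Objective p q n)}
    (hs : size (emb s) < n) : infNb (emb s) = (nb s).map emb := by
  rcases s with ⟨e, g⟩ | ⟨r, g⟩ | ⟨i, g⟩
  · have h : (of e * g.1).norm ≤ n := (FreeGroup.norm_mul_le _ _).trans (by
      rw [norm_of, add_comm]; exact hs)
    simp [nb, h, emb, infNb, Node.map]
  · simp [nb, emb, infNb, Node.map]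
  · simp [nb, emb, infNb, Node.map, agentOf]

theorem infInput_emb {ℓ : InfNode p q → ℕ}
    {s : Node (Agent p q n) (Constr p q n) (Objective p q n)} (hs : size (emb s) < n) :
    (network p q n (ℓ ∘ emb)).localInput s = infInput ℓ (emb s) := by
  rcases s with ⟨e, g⟩ | ⟨r, g⟩ | ⟨i, g⟩
  · have h : (of e * g.1).norm ≤ n := (FreeGroup.norm_mul_le _ _).trans (by
      rw [norm_of, add_comm]; exact hs)
    refine (Network.localInput_ofLists_agent _).trans ?_
    simp [nb, h, emb, infInput, Node.map, Node.kind, MaxMinLP.coeff, lp]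
  · refine congrArg (LocalInput.constraint _) ?_
    simp [network, Network.ofLists, nb]
  · refine congrArg (LocalInput.objective _) ?_
    simp [network, Network.ofLists, nb]

/-- Far from the boundary, the truncated and the infinite network have the same views. -/
theorem view_network {ℓ : InfNode p q → ℕ} {D : ℕ}
    {s : Node (Agent p q n) (Constr p q n) (Objective p q n)} (hs : size (emb s) + D < n) :
    (network p q n (ℓ ∘ emb)).view D s = infView ℓ D (emb s) := by
  classical
  induction D generalizing s with
  | zero => exact infInput_emb hs
  | succ D ih =>
    refine (Network.view_ofLists_succ D s).trans (Prod.ext (infInput_emb (by omega)) ?_)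
    simp only [infView, infNb_emb (s := s) (by omega), List.map_map]
    refine List.map_congr_left fun t ht => ?_
    have hsize : size (emb t) ≤ size (emb s) + 1 := size_le_of_mem_infNb (by
      rw [infNb_emb (by omega)]; exact List.mem_map_of_mem ht)
    refine Prod.ext ?_ (ih (by omega))
    simp only [Function.comp_apply, infNb_emb (s := t) (by omega)]
    convert (List.idxOf_map_of_injective emb_injective _ _).symm

/-- A right multiplication agrees with a permutation far from the boundary. -/
theorem exists_perm_shift (γ : FreeGroup (Fin p × Fin q)) (hγ : γ.norm ≤ 1) :
    ∃ τ : Equiv.Perm (Node (Agent p q n) (Constr p q n) (Objective p q n)),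
      ∀ s, size (emb s) < n → emb (τ s) = shift γ (emb s) := by
  classical
  have := Fintype.ofFinite (Node (Agent p q n) (Constr p q n) (Objective p q n))
  have hex : ∀ s : Node (Agent p q n) (Constr p q n) (Objective p q n),
      ∃ t : Node (Agent p q n) (Constr p q n) (Objective p q n),
        size (emb s) < n → emb t = shift γ (emb s) := by
    intro s
    by_cases hs : size (emb s) < n
    · obtain ⟨t, ht⟩ := exists_emb_eq (n := n) (s := shift γ (emb s))
        ((size_shift_le γ _).trans (by omega))
      exact ⟨t, fun _ => ht⟩
    · exact ⟨s, fun h => absurd h hs⟩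
  choose f hf using hex
  -- The shift is injective on the nodes of size below `n` and, as `γ` has norm at most 1, keeps
  -- them in the truncation. Such a partial injection of a finite type extends to a permutation.
  obtain ⟨τ, hτ⟩ := Finset.exists_equiv_extend_of_card_eq
    (t := (Finset.univ : Finset (Node (Agent p q n) (Constr p q n) (Objective p q n))))
    (s := Finset.univ.filter fun s => size (emb s) < n) (f := f) Finset.card_univ.symm
    (by simp) fun s hs t ht hst => by
      simp only [Finset.coe_filter, Finset.mem_univ, true_and, Set.mem_ofPred_eq] at hs ht
      have := (hf s hs).symm.trans ((congrArg emb hst).trans (hf t ht))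
      exact emb_injective (shift_injective γ this)
  refine ⟨τ.trans (Equiv.subtypeUnivEquiv (by simp)), fun s hs => ?_⟩
  rw [← hf s hs]
  exact congrArg emb (hτ s (by simpa using hs))

end TreeNetwork

/-! ### A feasible solution of large utility on the truncated network -/

namespace TreeNetwork

open FreeGroup

variable {p q n : ℕ}

noncomputable instance : Fintype (Ball p q n) := Fintype.ofFinite _

theorem sum_a_mul (i : Constr p q n) (x : Agent p q n → ℝ) :
    ∑ v, (lp p q n).a i v * x v = ∑ j, x ((j, i.1), i.2) := by
  classical
  simp [lp, Fintype.sum_prod_type, ite_and]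

theorem sum_c_mul (k : Objective p q n) (x : Agent p q n → ℝ) :
    ∑ v, (lp p q n).c k v * x v = ∑ r, x (agentOf k r) := by
  classical
  rw [← MaxMinLP.sum_filter_mul ((lp p q n).c_nonneg k)]
  refine (Finset.sum_nbij (agentOf k) (fun r _ => ?_) (fun r _ r' _ h => ?_) (fun v hv => ?_)
    fun r _ => ?_).symm
  · simp [c_pos_iff_exists]
  · simp only [agentOf, Prod.mk.injEq] at h
    exact h.1.2
  · simpa [c_pos_iff_exists] using hv
  · simp [lp, agentOf]

theorem admissible_lp : (lp p q n).Admissible p q := by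
  refine ⟨fun v => ⟨(v.1.2, v.2), by simp [a_pos_iff]⟩, fun i => ?_, fun k => ?_⟩
  · have : {v | 0 < (lp p q n).a i v} ⊆ (fun j => ((j, i.1), i.2)) '' (Set.univ : Set (Fin p)) := by
      rintro ⟨⟨j, r⟩, g⟩ h
      obtain ⟨h1, h2⟩ := a_pos_iff.1 h
      exact ⟨j, trivial, by simp_all⟩
    exact (Set.ncard_le_ncard this).trans ((Set.ncard_image_le).trans (by simp))
  · have : {v | 0 < (lp p q n).c k v} ⊆ agentOf k '' (Set.univ : Set (Fin q)) := by
      intro v h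
      obtain ⟨r, hr⟩ := c_pos_iff_exists.1 h
      exact ⟨r, trivial, hr⟩
    exact (Set.ncard_le_ncard this).trans ((Set.ncard_image_le).trans (by simp))

/-- A feasible solution in which the agents that lead away from the root of their component have
values close to `1` if they come after an objective, and close to `0` otherwise. -/
noncomputable def treeSolution (p q n : ℕ) (v : Agent p q n) : ℝ :=
  if (of v.1 * v.2.1).norm < v.2.1.norm then 1 - ((p * q : ℝ)⁻¹) ^ v.2.1.norm
  else ((p * q : ℝ)⁻¹) ^ v.2.1.norm / p

/-- At the constraint `(r, g)`, an agent has a large value only if its generator cancels the first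
letter of `g`, which happens for at most one agent. That value leaves room `t = (p q)⁻¹ ^ g.norm`,
enough for `p` shares `t / p`. -/
theorem feasible_treeSolution (hp : 2 ≤ p) (hq : 2 ≤ q) :
    (lp p q n).Feasible (treeSolution p q n) := by
  have hp' : (2 : ℝ) ≤ p := by exact_mod_cast hp
  have hq' : (2 : ℝ) ≤ q := by exact_mod_cast hq
  have hθ1 : ∀ m : ℕ, ((p * q : ℝ)⁻¹) ^ m ≤ 1 := fun m =>
    pow_le_one₀ (by positivity) (inv_le_one_of_one_le₀ (by nlinarith))
  constructor
  · rintro ⟨r, g⟩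
    rw [sum_a_mul]
    set t : ℝ := ((p * q : ℝ)⁻¹) ^ g.1.norm with ht
    have ht0 : 0 ≤ t := by positivity
    have ht1 : t ≤ 1 := hθ1 _
    have hpt : ∑ _j : Fin p, t / p = t := by
      simp only [Finset.sum_const, Finset.card_univ, Fintype.card_fin, nsmul_eq_mul]
      field_simp
    by_cases hj : ∃ j : Fin p, (of (j, r) * g.1).norm < g.1.norm
    · obtain ⟨j, hj⟩ := hj
      calc ∑ j, treeSolution p q n ((j, r), g)
          ≤ ∑ j', (t / p + if j' = j then 1 - t else 0) := by
            refine Finset.sum_le_sum fun j' _ => ?_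
            unfold treeSolution
            split_ifs with h1 h2 h2
            · have : 0 ≤ t / p := by positivity
              linarith
            · exfalso
              have h3 := (norm_of_mul (j, r) g.1).resolve_left (by omega)
              have h4 := (norm_of_mul (j', r) g.1).resolve_left (by dsimp only at h1; omega)
              have := h3.2.symm.trans h4.2
              simp only [Option.some.injEq, Prod.mk.injEq] at this
              exact h2 this.1.1.symm
            · dsimp only
              linarith
            · dsimp only
              linarith
        _ = 1 := by
            rw [Finset.sum_add_distrib, hpt]
            simp
    · push Not at hj
      calc ∑ j, treeSolution p q n ((j, r), g) = ∑ _j : Fin p, t / p :=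
            Finset.sum_congr rfl fun j _ => if_neg (not_lt.2 (hj j))
        _ ≤ 1 := hpt.trans_le ht1
  · intro v
    unfold treeSolution
    split_ifs
    · linarith [hθ1 v.2.1.norm]
    · positivity

/-- At most one agent of `k` has smaller norm than `k`; the others contribute `1 - t` each. If that
agent exists, its value `t p q ^ 2` outweighs the deficit `(q - 1) t`, because small values decay by
a factor `p q` per level. Otherwise all `q` agents contribute `1 - t`, with `t ≤ 1 / (p q)`. -/
theorem lt_sum_treeSolution (hp : 2 ≤ p) (hq : 2 ≤ q) (k : Objective p q n) :
    (q : ℝ) - 1 < ∑ v, (lp p q n).c k v * treeSolution p q n v := by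
  have hp' : (2 : ℝ) ≤ p := by exact_mod_cast hp
  have hq' : (2 : ℝ) ≤ q := by exact_mod_cast hq
  rw [sum_c_mul]
  set m := k.2.1.norm with hm
  set t : ℝ := ((p * q : ℝ)⁻¹) ^ (m + 1) with ht
  have ht0 : 0 < t := by positivity
  have hval : ∀ r, of (agentOf k r).1 * (agentOf k r).2.1 = k.2.1 := fun r => by simp [agentOf]
  have hchild : ∀ r, ((of (k.1, r))⁻¹ * k.2.1).norm = m + 1 →
      treeSolution p q n (agentOf k r) = 1 - t := by
    intro r hr
    change (agentOf k r).2.1.norm = m + 1 at hr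
    rw [treeSolution, hval, hr, if_pos (Nat.lt_succ_self _)]
  by_cases hr : ∃ r : Fin q, ((of (k.1, r))⁻¹ * k.2.1).norm ≠ m + 1
  · obtain ⟨r, hr⟩ := hr
    obtain ⟨hr1, hr2⟩ := (norm_inv_of_mul (k.1, r) k.2.1).resolve_left hr
    -- The norm is `m - 1`, two below the exponent in `t`, so the value is `t (p q) ^ 2 / p`.
    have hpar : treeSolution p q n (agentOf k r) = t * (p * q ^ 2) := by
      change (agentOf k r).2.1.norm + 1 = m at hr1
      rw [treeSolution, hval, if_neg (by omega), ht, ← hr1, pow_succ, pow_succ]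
      field_simp
    calc (q : ℝ) - 1 < ∑ r', ((1 - t) - if r' = r then 1 - t - t * (p * q ^ 2) else 0) := by
          simp only [Finset.sum_sub_distrib, Finset.sum_const, Finset.card_univ, Fintype.card_fin,
            nsmul_eq_mul, Finset.sum_ite_eq', Finset.mem_univ, if_true]
          have : 0 < t * (p * q ^ 2 + 1 - q) := mul_pos ht0 (by nlinarith)
          linarith
      _ ≤ _ := by
          refine Finset.sum_le_sum fun r' _ => ?_
          split_ifs with h
          · rw [h, hpar]
            linarith
          · rw [hchild r', sub_zero]
            refine (norm_inv_of_mul (k.1, r') k.2.1).resolve_right fun h' => h ?_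
            have := h'.2.symm.trans hr2
            simp only [Option.some.injEq, Prod.mk.injEq] at this
            exact this.1.2
  · push Not at hr
    rw [Finset.sum_congr rfl fun r _ => hchild r (hr r)]
    simp only [Finset.sum_const, Finset.card_univ, Fintype.card_fin, nsmul_eq_mul]
    have h1 : t ≤ (p * q : ℝ)⁻¹ := by
      rw [ht]
      exact pow_le_of_le_one (by positivity) (inv_le_one_of_one_le₀ (by nlinarith)) (by omega)
    have h2 : q * (p * q : ℝ)⁻¹ < 1 := by
      rw [mul_inv, mul_comm, mul_assoc, inv_mul_cancel₀ (by positivity), mul_one]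
      exact inv_lt_one_of_one_lt₀ (by linarith)
    nlinarith

theorem lt_utility_treeSolution (hp : 2 ≤ p) (hq : 2 ≤ q) :
    (q : ℝ) - 1 < (lp p q n).utility (treeSolution p q n) := by
  have : Nonempty (Objective p q n) := ⟨(⟨0, by omega⟩, ⟨1, by simp⟩)⟩
  obtain ⟨k, hk⟩ := exists_eq_ciInf_of_finite
    (f := fun k => ∑ v, (lp p q n).c k v * treeSolution p q n v)
  exact (lt_sum_treeSolution hp hq k).trans_eq hk

/-! ### Averaging over identifiers and the lower bound -/

/-- The labels of the infinite network that are obtained from a permutation of the nodes of the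
truncated network. -/
noncomputable def permLabel
    (σ : Equiv.Perm (Node (Agent p q n) (Constr p q n) (Objective p q n))) : InfNode p q → ℕ :=
  Function.extend emb (fun s => (Finite.equivFin _ (σ s) : ℕ)) 0

theorem permLabel_emb (σ : Equiv.Perm (Node (Agent p q n) (Constr p q n) (Objective p q n)))
    (s : Node (Agent p q n) (Constr p q n) (Objective p q n)) :
    permLabel σ (emb s) = (Finite.equivFin _ (σ s) : ℕ) :=
  emb_injective.extend_apply _ _ _

theorem permLabel_comp_emb_injective
    (σ : Equiv.Perm (Node (Agent p q n) (Constr p q n) (Objective p q n))) :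
    (permLabel σ ∘ emb (n := n)).Injective := by
  intro s t h
  simp only [Function.comp_apply, permLabel_emb] at h
  exact σ.injective ((Finite.equivFin _).injective (Fin.ext h))

/-- Averaged over all permutations of the labels, the output of an agent does not change under a
right multiplication. -/
theorem sum_output_shift [Fintype (Equiv.Perm (Node (Agent p q n) (Constr p q n) (Objective p q n)))]
    {D : ℕ} (𝒜 : LocalAlgorithm ℕ D) {γ : FreeGroup (Fin p × Fin q)} (hγ : γ.norm ≤ 1)
    {v w : Agent p q n} (hw : shift γ (emb (.agent v)) = emb (.agent w))
    (hv : v.2.1.norm + D < n) (hw' : w.2.1.norm + D < n) :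
    ∑ σ : Equiv.Perm (Node (Agent p q n) (Constr p q n) (Objective p q n)),
        𝒜.output (network p q n (permLabel σ ∘ emb)) w =
      ∑ σ : Equiv.Perm (Node (Agent p q n) (Constr p q n) (Objective p q n)),
        𝒜.output (network p q n (permLabel σ ∘ emb)) v := by
  obtain ⟨τ, hτ⟩ := exists_perm_shift (n := n) γ hγ
  -- The view of `w` under the labelling `σ` equals the view of `v` under `σ * τ`, so reindexing the
  -- sum matches the outputs.
  refine Fintype.sum_equiv (Equiv.mulRight τ) _ _ fun σ => ?_
  unfold LocalAlgorithm.output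
  rw [view_network (s := .agent w) hw', view_network (s := .agent v) hv, ← hw,
    ← infView_comp_shift]
  congr 1
  refine infView_congr fun t ht => ?_
  have ht' : size t < n := lt_of_le_of_lt ht hv
  obtain ⟨s, rfl⟩ := exists_emb_eq ht'.le
  rw [Function.comp_apply, ← hτ s ht', permLabel_emb, permLabel_emb]
  rfl

end TreeNetwork

open TreeNetwork FreeGroup in
theorem LocalAlgorithm.HasRatioWithIdentifiers.lt {p q : ℕ} (hp : 2 ≤ p) (hq : 2 ≤ q) {D : ℕ}
    {𝒜 : LocalAlgorithm ℕ D} {α : ℝ} (h : 𝒜.HasRatioWithIdentifiers p q α) :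
    (p : ℝ) * (1 - 1 / (q : ℝ)) < α := by
  classical
  have hp' : (2 : ℝ) ≤ p := by exact_mod_cast hp
  have hq' : (2 : ℝ) ≤ q := by exact_mod_cast hq
  -- The agents compared have norm at most 1, so their views of radius `D` do not reach the
  -- boundary.
  let n := D + 2
  let W := Node (Agent p q n) (Constr p q n) (Objective p q n)
  have : Fintype W := Fintype.ofFinite W
  have : NeZero p := ⟨by omega⟩
  let out (σ : Equiv.Perm W) : Agent p q n → ℝ :=
    𝒜.output (network p q n (permLabel σ ∘ emb))
  let one : Ball p q (n + 1) := ⟨1, by simp⟩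
  let root (i : Fin p) : Objective p q n := (i, ⟨1, by simp⟩)
  have happ (σ : Equiv.Perm W) : 𝒜.ApproximatesOn (network p q n (permLabel σ ∘ emb)) α :=
    h _ _ _ (network p q n (permLabel σ ∘ emb)) (permLabel_comp_emb_injective σ) admissible_lp
  have hfeas (σ : Equiv.Perm W) : (lp p q n).Feasible (out σ) := (happ σ).1
  have hopt (σ : Equiv.Perm W) : (q : ℝ) - 1 < α * (lp p q n).utility (out σ) :=
    (lt_utility_treeSolution hp hq).trans_le ((happ σ).2 _ (feasible_treeSolution hp hq))
  have hα : 0 < α := by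
    have h1 := hopt 1
    have h2 : 0 ≤ (lp p q n).utility (out 1) := Real.iInf_nonneg fun k =>
      Finset.sum_nonneg fun v _ => mul_nonneg ((lp p q n).c_nonneg k v) ((hfeas 1).2 v)
    by_contra! h3
    nlinarith
  have hobj (σ : Equiv.Perm W) (i : Fin p) :
      (q : ℝ) - 1 < α * ∑ r, out σ (agentOf (root i) r) := by
    refine (hopt σ).trans_le (mul_le_mul_of_nonneg_left ?_ hα.le)
    exact (MaxMinLP.utility_le _ (root i)).trans_eq (sum_c_mul _ _)
  have hcon (σ : Equiv.Perm W) (r : Fin q) : ∑ i, out σ ((i, r), one) ≤ 1 :=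
    (sum_a_mul (n := n) (r, one) (out σ)).symm.trans_le ((hfeas σ).1 (r, one))
  -- The agent of type `(i, r)` next to the objective `(i, 1)` is the translate of the one at the
  -- identity by the inverse generator.
  have hshift (i : Fin p) (r : Fin q) :
      ∑ σ, out σ (agentOf (root i) r) = ∑ σ, out σ ((i, r), one) := by
    refine sum_output_shift 𝒜 (γ := (of (i, r))⁻¹) (by simp) ?_ ?_ ?_
    · simp [shift, emb, Node.map, agentOf, root, one]
    · simp [one, n]
    · simp only [agentOf, root, mul_one, norm_inv_eq, norm_of, n]
      omega
  have hlow : (Fintype.card (Equiv.Perm W) : ℝ) * (p * (q - 1)) <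
      α * ∑ σ : Equiv.Perm W, ∑ i, ∑ r, out σ (agentOf (root i) r) := by
    simp only [Finset.mul_sum]
    calc (Fintype.card (Equiv.Perm W) : ℝ) * (p * (q - 1))
        = ∑ _σ : Equiv.Perm W, ∑ _i : Fin p, ((q : ℝ) - 1) := by simp [mul_sub]
      _ < _ := Finset.sum_lt_sum_of_nonempty Finset.univ_nonempty fun σ _ =>
          Finset.sum_lt_sum_of_nonempty Finset.univ_nonempty fun i _ => by
            rw [← Finset.mul_sum]
            exact hobj σ i
  have hupp : ∑ σ : Equiv.Perm W, ∑ i, ∑ r, out σ (agentOf (root i) r) ≤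
      (Fintype.card (Equiv.Perm W) : ℝ) * q := by
    calc ∑ σ : Equiv.Perm W, ∑ i, ∑ r, out σ (agentOf (root i) r)
        = ∑ i, ∑ r, ∑ σ, out σ (agentOf (root i) r) := by
          rw [Finset.sum_comm]
          exact Finset.sum_congr rfl fun i _ => Finset.sum_comm
      _ = ∑ i, ∑ r, ∑ σ, out σ ((i, r), one) := by simp_rw [hshift]
      _ = ∑ σ, ∑ r, ∑ i, out σ ((i, r), one) := by
          rw [Finset.sum_comm, Finset.sum_comm (s := (Finset.univ : Finset (Equiv.Perm W)))]
          exact Finset.sum_congr rfl fun r _ => Finset.sum_comm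
      _ ≤ ∑ _σ : Equiv.Perm W, ∑ _r : Fin q, (1 : ℝ) :=
          Finset.sum_le_sum fun σ _ => Finset.sum_le_sum fun r _ => hcon σ r
      _ = (Fintype.card (Equiv.Perm W) : ℝ) * q := by simp
  have hM : (0 : ℝ) < Fintype.card (Equiv.Perm W) := by exact_mod_cast Fintype.card_pos
  have hfin : (p : ℝ) * (q - 1) < α * q := by
    have := hlow.trans_le (mul_le_mul_of_nonneg_left hupp hα.le)
    rw [mul_left_comm α] at this
    exact lt_of_mul_lt_mul_left this hM.le
  have : (p : ℝ) * (1 - 1 / q) = p * (q - 1) / q := by field_simp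
  rw [this, div_lt_iff₀ (by linarith)]
  exact hfin

theorem theorem2 :
    -- the approximation guarantee, without identifiers
    (∀ ΔI ΔK : ℕ, 2 ≤ ΔI → 2 ≤ ΔK → ∀ ε : ℝ, 0 < ε →
      ∃ (D : ℕ) (𝒜 : LocalAlgorithm Unit D),
        𝒜.HasRatio ΔI ΔK ((ΔI : ℝ) * (1 - 1 / (ΔK : ℝ)) + ε)) ∧
    -- the local horizon in terms of the parameter `R`, which alone determines the algorithm
    (∃ D : ℕ → ℕ, (fun R => (D R : ℝ)) =Θ[atTop] (fun R => (R : ℝ)) ∧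
      ∀ R : ℕ, 2 ≤ R → ∃ 𝒜 : LocalAlgorithm Unit (D R),
        ∀ ΔI ΔK : ℕ, 2 ≤ ΔI → 2 ≤ ΔK →
          𝒜.HasRatio ΔI ΔK
            ((ΔI : ℝ) * (1 - 1 / (ΔK : ℝ)) * (1 + 1 / ((R : ℝ) - 1)))) ∧
    -- optimality among all local algorithms, even those that use unique identifiers
    (∀ ΔI ΔK : ℕ, 2 ≤ ΔI → 2 ≤ ΔK →
      ∀ (D : ℕ) (𝒜 : LocalAlgorithm ℕ D) (α : ℝ),
        𝒜.HasRatioWithIdentifiers ΔI ΔK α → (ΔI : ℝ) * (1 - 1 / (ΔK : ℝ)) < α) := by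
  refine ⟨fun ΔI ΔK hΔI hΔK ε hε => LocalAlgorithm.exists_hasRatio_add hΔI hΔK hε,
    ⟨fun R => 12 * R, ?_, fun R hR => LocalAlgorithm.exists_hasRatio hR⟩,
    fun ΔI ΔK hΔI hΔK D 𝒜 α h => h.lt hΔI hΔK⟩
  simp only [Nat.cast_mul]
  exact (isTheta_refl _ _).const_mul_left (by norm_num)
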